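/- Let $n\ge1$ and let $\Delta=\{x\in\mathbb{R}^n: 1\ge x_1\ge x_2\ge\cdots\ge x_n\ge0\}$ be the simplex with vertices $v_1=(0,\ldots,0)$ and $v_j$ ($2\le j\le n+1$), where $v_j$ has its first $n+2-j$ coordinates equal to $1$ and the others equal to $0$. Let $\Delta_0=\{x\in\Delta:x_1+x_n\le1\}$ and $\Delta_1=\{x\in\Delta:x_1+x_n\ge1\}$. The Mönkemeyer map $M:\Delta\to\Delta$ and the tent map $T:\Delta\to\Delta$ are $$M(x)=\begin{cases}\bigl(\tfrac{x_1}{1-x_n},\tfrac{x_1-x_n}{1-x_n},\ldots,\tfrac{x_{n-1}-x_n}{1-x_n}\bigr),& x\in\Delta_0,\\ \bigl(\tfrac{1-x_n}{x_1},\tfrac{x_1-x_n}{x_1},\ldots,\tfrac{x_{n-1}-x_n}{x_1}\bigr),& x\in\Delta_1,\end{cases}$$ $$T(x)=\begin{cases}(x_1+x_n,\,x_1-x_n,\ldots,x_{n-1}-x_n),& x\in\Delta_0,\\ (2-x_1-x_n,\,x_1-x_n,\ldots,x_{n-1}-x_n),& x\in\Delta_1.\end{cases}$$ For $f\in\{M,T\}$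 and $t\ge0$, the time-$t$ partition for $f$ is the simplicial complex whose maximal simplexes are the $2^t$ simplexes $\{x\in\Delta: f^i(x)\in\Delta_{a_i}\text{ for }0\le i<t\}$, where $a_0,\ldots,a_{t-1}\in\{0,1\}$; it is denoted $\mathcal{F}_t$ for $f=M$ and $\mathcal{B}_t$ for $f=T$. For $p\in\Delta$ put $$\mathrm{GO}_f(p)=\{q\in\Delta: f^t(p)=f^s(q)\text{ for some }t,s\ge0\},$$ $$\mathrm{EPO}_f(p)=\{q\in\Delta: q=f^t(p)=f^s(p)\text{ for some }0\le t<s\},$$ and call $p$ $f$-preperiodic if $\mathrm{EPO}_f(p)\ne\emptyset$. The point $p=(\alpha_1,\ldots,\alpha_n)$ is rational (dyadic) if all $\alpha_i$ are in $\mathbb{Q}$ (in $\mathbb{Z}[1/2]$), and $\mathbb{Q}(p)=\mathbb{Q}(\alpha_1,\ldots,\alpha_n)$. **Theorem.** Let $p\in\Delta$. Then: (i) $p$ is rational iff $\mathrm{EPO}_M(p)=\{v_1\}$ iff $p$ is a vertex of some $\mathcal{F}_t$; (ii) $p$ is dyadic iff $\mathrm{EPO}_T(p)=\{v_1\}$ iff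 $p$ is a vertex of some $\mathcal{B}_t$. In particular, the set of rational points of $\Delta$ is $\mathrm{GO}_M(v_1)$, the set of dyadic points of $\Delta$ is $\mathrm{GO}_T(v_1)$, and the former is mapped bijectively onto the latter by $\Phi$, where $\Phi$ is the homeomorphism $\Delta\to\Delta$ with $T=\Phi\circ M\circ\Phi^{-1}$, which exists and is unique. Moreover: (iii) $[\mathbb{Q}(p):\mathbb{Q}]\le n+1$ if $p$ is $M$-preperiodic; (iv) $p$ is rational iff $p$ is $T$-preperiodic. -/

import Mathlib

namespace Monkemeyer

/-- The last index of `Fin n`, for `n ≥ 1`. -/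
def lastIdx (n : ℕ) [NeZero n] : Fin n := ⟨n - 1, Nat.sub_one_lt (NeZero.ne n)⟩

/-- The index `i - 1` (used below only for `i ≠ 0`). -/
def prevIdx {n : ℕ} (i : Fin n) : Fin n := ⟨(i : ℕ) - 1, lt_of_le_of_lt (Nat.sub_le _ _) i.2⟩

/-- The vertices `v₁, …, v_{n+1}` of the simplex `Δ`, indexed here by `j = 0, …, n`:
`vertex 0` is the origin, and for `j ≥ 1` the first `n + 1 - j` coordinates of `vertex j` are `1`
and the other ones are `0`. -/
def vertex (n : ℕ) (j : Fin (n + 1)) : Fin n → ℝ :=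
  fun i => if j ≠ 0 ∧ (i : ℕ) + (j : ℕ) ≤ n then 1 else 0

/-- The simplex `Δ` in `ℝⁿ`. -/
def Delta (n : ℕ) : Set (Fin n → ℝ) := convexHull ℝ (Set.range (vertex n))

/-- `Δ = {x : 1 ≥ x₁ ≥ x₂ ≥ ⋯ ≥ xₙ ≥ 0}`. -/
theorem mem_Delta_iff {n : ℕ} [NeZero n] (x : Fin n → ℝ) :
    x ∈ Delta n ↔ x 0 ≤ 1 ∧ (∀ i j : Fin n, i ≤ j → x j ≤ x i) ∧ 0 ≤ x (lastIdx n) := by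
  constructor
  · intro hx
    have hconv : Convex ℝ {x : Fin n → ℝ |
        x 0 ≤ 1 ∧ (∀ i j : Fin n, i ≤ j → x j ≤ x i) ∧ 0 ≤ x (lastIdx n)} := by
      rintro x ⟨h1, h2, h3⟩ y ⟨k1, k2, k3⟩ a b ha hb hab
      refine ⟨?_, ?_, ?_⟩
      · simp only [Pi.add_apply, Pi.smul_apply, smul_eq_mul]
        nlinarith
      · intro i j hij
        simp only [Pi.add_apply, Pi.smul_apply, smul_eq_mul]
        have := mul_le_mul_of_nonneg_left (h2 i j hij) ha
        have := mul_le_mul_of_nonneg_left (k2 i j hij) hb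
        linarith
      · simp only [Pi.add_apply, Pi.smul_apply, smul_eq_mul]
        positivity
    refine convexHull_min ?_ hconv hx
    rintro _ ⟨j, rfl⟩
    refine ⟨?_, ?_, ?_⟩
    · unfold vertex; split_ifs <;> norm_num
    · intro i k hik
      have hik' : (i : ℕ) ≤ k := hik
      unfold vertex
      by_cases h : j ≠ 0 ∧ (k : ℕ) + (j : ℕ) ≤ n
      · have h' : j ≠ 0 ∧ (i : ℕ) + (j : ℕ) ≤ n := ⟨h.1, by omega⟩
        rw [if_pos h, if_pos h']
      · rw [if_neg h]
        split_ifs <;> norm_num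
    · unfold vertex; split_ifs <;> norm_num
  · rintro ⟨h1, h2, h3⟩
    have hn : 0 < n := Nat.pos_of_ne_zero (NeZero.ne n)
    -- the sequence `1, x₁, …, xₙ, 0`
    let z : ℕ → ℝ := fun k =>
      if k = 0 then 1 else if h : k - 1 < n then x ⟨k - 1, h⟩ else 0
    have hz0 : z 0 = 1 := by simp [z]
    have hzs : ∀ i : Fin n, z ((i : ℕ) + 1) = x i := fun i => by simp [z]
    have hzl : z (n + 1) = 0 := by simp [z]
    have hxnn : ∀ i, 0 ≤ x i := fun i =>
      h3.trans (h2 i (lastIdx n) (by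
        have := i.2
        change (i : ℕ) ≤ n - 1
        omega))
    have hzm : ∀ c, c ≤ n → 0 ≤ z c - z (c + 1) := by
      intro c hc
      rcases Nat.eq_zero_or_pos c with rfl | hc0
      · have := hzs ⟨0, hn⟩
        simp only at this
        rw [hz0, this]
        have : (⟨0, hn⟩ : Fin n) = 0 := Fin.ext (by simp)
        rw [this]; linarith
      · obtain ⟨d, rfl⟩ : ∃ d, c = d + 1 := ⟨c - 1, by omega⟩
        have e1 := hzs ⟨d, by omega⟩
        simp only at e1
        rw [e1]
        rcases Nat.lt_or_ge (d + 1) n with hd | hd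
        · have e2 := hzs ⟨d + 1, hd⟩
          simp only at e2
          rw [e2]
          have := h2 ⟨d, by omega⟩ ⟨d + 1, hd⟩ (by change d ≤ d + 1; omega)
          linarith
        · have : d + 1 = n := by omega
          rw [this, hzl]
          linarith [hxnn ⟨d, by omega⟩]
    let u : ℕ → Fin n → ℝ := fun c i => if (i : ℕ) < c then 1 else 0
    have hu : ∀ c ∈ Finset.range (n + 1), u c ∈ Delta n := by
      intro c hc
      have hc : c < n + 1 := Finset.mem_range.1 hc
      refine subset_convexHull ℝ _ ?_
      rcases Nat.eq_zero_or_pos c with rfl | hc0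
      · exact ⟨0, by funext i; simp [u, vertex]⟩
      · refine ⟨⟨n + 1 - c, by omega⟩, ?_⟩
        funext i
        have : (⟨n + 1 - c, by omega⟩ : Fin (n + 1)) ≠ 0 := by
          intro h
          have := congrArg Fin.val h
          simp at this
          omega
        by_cases hic : (i : ℕ) < c
        · have : (i : ℕ) + (n + 1 - c) ≤ n := by omega
          simp [u, vertex, *]
        · have : ¬ (i : ℕ) + (n + 1 - c) ≤ n := by omega
          simp [u, vertex, *]
    have key : x = ∑ c ∈ Finset.range (n + 1), (z c - z (c + 1)) • u c := by
      funext i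
      have hi := i.2
      rw [Finset.sum_apply]
      simp only [Pi.smul_apply, smul_eq_mul]
      have : ∀ m, m ≤ n + 1 → ∑ c ∈ Finset.range m, (z c - z (c + 1)) * u c i
          = if (i : ℕ) < m then z (i + 1) - z m else 0 := by
        intro m
        induction m with
        | zero => simp
        | succ m ih =>
          intro hm
          rw [Finset.sum_range_succ, ih (by omega)]
          rcases lt_trichotomy (i : ℕ) m with h | h | h
          · simp [u, h, Nat.lt_succ_of_lt h]
          · simp [u, h]
          · simp [u, Nat.not_lt.2 h.le, show ¬ (i : ℕ) < m + 1 by omega]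
      rw [this (n + 1) le_rfl, if_pos (by omega), hzl, hzs, sub_zero]
    rw [key]
    refine (convex_convexHull ℝ _).sum_mem (fun c hc => hzm c ?_) ?_ hu
    · have := Finset.mem_range.1 hc
      omega
    · rw [Finset.sum_range_sub', hz0, hzl, sub_zero]

/-- The Mönkemeyer map in affine coordinates, on all of `ℝⁿ`. -/
noncomputable def monkemeyerFun {n : ℕ} [NeZero n] (x : Fin n → ℝ) : Fin n → ℝ := fun i =>
  if x 0 + x (lastIdx n) ≤ 1 then
    if i = 0 then x 0 / (1 - x (lastIdx n))
    else (x (prevIdx i) - x (lastIdx n)) / (1 - x (lastIdx n))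
  else
    if i = 0 then (1 - x (lastIdx n)) / x 0
    else (x (prevIdx i) - x (lastIdx n)) / x 0

/-- The tent map in affine coordinates, on all of `ℝⁿ`. -/
noncomputable def tentFun {n : ℕ} [NeZero n] (x : Fin n → ℝ) : Fin n → ℝ := fun i =>
  if x 0 + x (lastIdx n) ≤ 1 then
    if i = 0 then x 0 + x (lastIdx n)
    else x (prevIdx i) - x (lastIdx n)
  else
    if i = 0 then 2 - x 0 - x (lastIdx n)
    else x (prevIdx i) - x (lastIdx n)

theorem le_lastIdx {n : ℕ} [NeZero n] (i : Fin n) : i ≤ lastIdx n := by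
  have := i.2
  change (i : ℕ) ≤ n - 1
  omega

theorem zero_le_idx {n : ℕ} [NeZero n] (i : Fin n) : 0 ≤ i := by
  change ((0 : Fin n) : ℕ) ≤ i
  simp

theorem prevIdx_mono {n : ℕ} {i j : Fin n} (h : i ≤ j) : prevIdx i ≤ prevIdx j := by
  have h' : (i : ℕ) ≤ j := h
  change (i : ℕ) - 1 ≤ j - 1
  omega

theorem tentFun_mem {n : ℕ} [NeZero n] {x : Fin n → ℝ} (hx : x ∈ Delta n) :
    tentFun x ∈ Delta n := by
  rw [mem_Delta_iff] at hx ⊢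
  obtain ⟨h1, h2, h3⟩ := hx
  have hl : ∀ i, x (lastIdx n) ≤ x i := fun i => h2 _ _ (le_lastIdx i)
  have h0 : ∀ i, x i ≤ x 0 := fun i => h2 _ _ (zero_le_idx i)
  have hl0 := hl 0
  refine ⟨?_, ?_, ?_⟩
  · unfold tentFun; split_ifs <;> first | linarith | (exfalso; simp_all)
  · intro i j hij
    have a1 := h2 _ _ (prevIdx_mono hij)
    have a2 := h0 (prevIdx j)
    have hij0 : j = 0 → i = 0 := fun h => le_antisymm (h ▸ hij) (zero_le_idx i)
    unfold tentFun; split_ifs <;> first | linarith | (exfalso; simp_all)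
  · have a1 := hl (prevIdx (lastIdx n))
    unfold tentFun; split_ifs <;> linarith

theorem monkemeyerFun_mem {n : ℕ} [NeZero n] {x : Fin n → ℝ} (hx : x ∈ Delta n) :
    monkemeyerFun x ∈ Delta n := by
  rw [mem_Delta_iff] at hx ⊢
  obtain ⟨h1, h2, h3⟩ := hx
  have hl : ∀ i, x (lastIdx n) ≤ x i := fun i => h2 _ _ (le_lastIdx i)
  have h0 : ∀ i, x i ≤ x 0 := fun i => h2 _ _ (zero_le_idx i)
  have hl0 := hl 0
  by_cases hc : x 0 + x (lastIdx n) ≤ 1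
  · have hd : 0 < 1 - x (lastIdx n) := by
      rcases h3.lt_or_eq with h | h <;> linarith
    refine ⟨?_, ?_, ?_⟩
    · simp only [monkemeyerFun, if_pos hc, if_true]
      rw [div_le_one hd]; linarith
    · intro i j hij
      have a1 := h2 _ _ (prevIdx_mono hij)
      have a2 := h0 (prevIdx j)
      have hij0 : j = 0 → i = 0 := fun h => le_antisymm (h ▸ hij) (zero_le_idx i)
      simp only [monkemeyerFun, if_pos hc]
      split_ifs <;>
        first
        | exact div_le_div_of_nonneg_right (by linarith) hd.le
        | (exfalso; simp_all)
    · have a1 := hl (prevIdx (lastIdx n))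
      simp only [monkemeyerFun, if_pos hc]
      split_ifs <;> exact div_nonneg (by linarith) hd.le
  · have hd : 0 < x 0 := by
      by_contra hd
      exact hc (by linarith)
    refine ⟨?_, ?_, ?_⟩
    · simp only [monkemeyerFun, if_neg hc, if_true]
      rw [div_le_one hd]; linarith
    · intro i j hij
      have a1 := h2 _ _ (prevIdx_mono hij)
      have a2 := h0 (prevIdx j)
      have hij0 : j = 0 → i = 0 := fun h => le_antisymm (h ▸ hij) (zero_le_idx i)
      simp only [monkemeyerFun, if_neg hc]
      split_ifs <;>
        first
        | exact div_le_div_of_nonneg_right (by linarith) hd.le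
        | (exfalso; simp_all)
    · have a1 := hl (prevIdx (lastIdx n))
      simp only [monkemeyerFun, if_neg hc]
      split_ifs <;> exact div_nonneg (by linarith) hd.le

/-- The Mönkemeyer map `M : Δ → Δ`. -/
noncomputable def M (n : ℕ) [NeZero n] (x : Delta n) : Delta n :=
  ⟨monkemeyerFun x.1, monkemeyerFun_mem x.2⟩

/-- The tent map `T : Δ → Δ`. -/
noncomputable def T (n : ℕ) [NeZero n] (x : Delta n) : Delta n :=
  ⟨tentFun x.1, tentFun_mem x.2⟩

/-- The vertex `v₁ = 0` of `Δ`. -/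
def v₁ (n : ℕ) : Delta n := ⟨vertex n 0, subset_convexHull ℝ _ ⟨0, rfl⟩⟩

/-- The two halves of `Δ`: `half n false` is `Δ₀ = {x ∈ Δ : x₁ + xₙ ≤ 1}` and
`half n true` is `Δ₁ = {x ∈ Δ : x₁ + xₙ ≥ 1}`. -/
def half (n : ℕ) [NeZero n] (a : Bool) : Set (Delta n) :=
  if a then {x | 1 ≤ x.1 0 + x.1 (lastIdx n)} else {x | x.1 0 + x.1 (lastIdx n) ≤ 1}

/-- The cell of the word `a₀ … a_{t-1}`: the points `x` of `Δ` such that `fⁱ(x)` lies in the half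
`Δ_{aᵢ}` for all `i < t`. -/
def cell {n : ℕ} [NeZero n] (f : Delta n → Delta n) {t : ℕ} (a : Fin t → Bool) :
    Set (Delta n) :=
  {x | ∀ i : Fin t, f^[(i : ℕ)] x ∈ half n (a i)}

/-- The maximal simplexes of the time-`t` partition for `f` (for `f = M` this is `𝓕_t`, for
`f = T` it is `𝓑_t`), as subsets of `ℝⁿ`. -/
def timePartition {n : ℕ} [NeZero n] (f : Delta n → Delta n) (t : ℕ) :
    Set (Set (Fin n → ℝ)) :=
  Set.range fun a : Fin t → Bool => Subtype.val '' cell f a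

/-- `p` is a vertex of the time-`t` partition for `f`, that is, a vertex (an extreme point) of one
of its maximal simplexes. -/
def IsVertexOfTimePartition {n : ℕ} [NeZero n] (f : Delta n → Delta n) (t : ℕ)
    (p : Delta n) : Prop :=
  ∃ S ∈ timePartition f t, p.1 ∈ S.extremePoints ℝ

/-- The grand orbit of `p` under `f`. -/
def GO {X : Type*} (f : X → X) (p : X) : Set X :=
  {q | ∃ t s : ℕ, f^[t] p = f^[s] q}

/-- The eventual periodic orbit of `p` under `f`. -/
def EPO {X : Type*} (f : X → X) (p : X) : Set X :=
  {q | ∃ t s : ℕ, t < s ∧ q = f^[t] p ∧ q = f^[s] p}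

/-- `p` is preperiodic under `f`. -/
def IsPreperiodic {X : Type*} (f : X → X) (p : X) : Prop := (EPO f p).Nonempty

/-- All the coordinates of `p` are rational. -/
def IsRationalPoint {n : ℕ} (p : Delta n) : Prop := ∀ i, ∃ q : ℚ, p.1 i = (q : ℝ)

/-- All the coordinates of `p` are dyadic rationals. -/
def IsDyadicPoint {n : ℕ} (p : Delta n) : Prop :=
  ∀ i, ∃ (a : ℤ) (m : ℕ), p.1 i = (a : ℝ) / 2 ^ m

/-- The field `ℚ(p)` generated over `ℚ` by the coordinates of `p`. -/
noncomputable def coordField {n : ℕ} (p : Delta n) : IntermediateField ℚ ℝ :=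
  IntermediateField.adjoin ℚ (Set.range p.1)

/-- The homeomorphism `Φ` of `Δ` conjugates the Mönkemeyer map with the tent map. -/
def IsMinkowski {n : ℕ} [NeZero n] (Φ : Delta n ≃ₜ Delta n) : Prop :=
  T n = Φ ∘ M n ∘ Φ.symm

end Monkemeyer

/-!
In the barycentric coordinates `(μ₁, …, μ_{n+1})` of `Δ` with respect to `v₁, …, v_{n+1}`, both maps
are, up to normalization, the piecewise linear map
`(μ₁, …, μ_{n+1}) ↦ (|μ₁ - μ₂|, μ₃, …, μ_{n+1}, κ min(μ₁, μ₂))`,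
with `κ = 1` for the Mönkemeyer map and `κ = 2` for the tent map (`isModel_M`, `isModel_T`). Almost
everything is proved for both at once, from `IsModel κ f`. The coordinate `μ₁` is the head and
`μ₂, …, μ_{n+1}` is a queue: at each step the front leaves the queue and a new element enters it.

*Itineraries determine points* (`IsPrimal.unique`, `eq_of_itinerary`). Dually, the vertices of the
nested simplexes of an itinerary are listed by a queue in which the vertex `(H + G) / κ` enters,
where `H` is the head and `G` the front, and then `H` or `G` becomes the head. Let `D` be the
denominators (the weights of the vertices) and let `L` be the values of another linear functional;
all quotients `L / D` have to converge to the same limit. If the head is eventually constant, this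
is direct. Otherwise there are infinitely many times at which all weights are within a factor `2` of
each other (`weights_comparable`), and a fixed number of steps after such a time the range of
`L / D` has shrunk by a definite factor (`Bracket.contract`). The reason is combinatorial
(`marks_extinct`): call an element red if all its ancestors have a large quotient, and blue if all
of them have a small one. The number of red or blue elements never increases, and it is strictly
smaller after `2n + 1` steps if both colours survive, because a red head is stuck when it meets a
blue front. So one colour dies out, and this bounds all quotients away from one end of the range.

*The homeomorphism* `Φ`. Relate `x` to `y` if at all times the `M`-orbit of `x` and the `T`-orbit of
`y` share a half of `Δ`. This relation is closed. Since inverse branches of the two maps act in the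
same way on faces, compactness gives every `x` a partner `y` whose orbit hits the wall between the
halves whenever that of `x` does (`exists_shadow`); with the first part this makes the relation the
graph of a bijection, which is a homeomorphism. Conversely, a conjugating homeomorphism preserves
the wall, which is the set of points that are alone in their fibre, and the facet onto which the
wall is mapped. That facet is contained in `Δ₁` and not in the wall, so the halves are preserved
too, and the homeomorphism is the one constructed.

*Rational and dyadic points.* For the Mönkemeyer map the common denominator of the coordinates
decreases as in the Euclidean algorithm until `v₁` is reached; for the tent map, `n` steps divide a
common denominator `2 ^ k` by `2`. Conversely, inverse branches of the maps preserve rational and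
dyadic points, respectively. The vertices of the partitions are the
preimages of those of `Δ`, because the iterates preserve segments on cells.

*Preperiodic points.* The coordinates of a periodic point are multiplied by some `c` after a period.
Projecting `ℝ` linearly onto `ℚ(c)` gives a second solution of the same linear recurrence, and a
small multiple of the difference may be added without destroying nonnegativity. Since itineraries
determine points, the difference is `0`, so the coordinates lie in `ℚ(c)`
(`IsPrimal.mem_of_periodic`). For the Mönkemeyer map, `c` is an eigenvalue of a rational matrix of
size `n + 1`; for the tent map, `c = 1`.
-/

namespace Monkemeyer

/-! ### Barycentric coordinates -/

/-- The coordinates of `x`, continued by `0` beyond the last one. -/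
noncomputable def ext {n : ℕ} (x : Delta n) (j : ℕ) : ℝ := if h : j < n then x.1 ⟨j, h⟩ else 0

/-- The barycentric coordinate of `x` at the vertex `v₁` of `Δ`. -/
noncomputable def hd {n : ℕ} [NeZero n] (x : Delta n) : ℝ := 1 - x.1 0

/-- For `i < n`, the barycentric coordinate of `x` at the vertex `v_{i+2}` of `Δ`. -/
noncomputable def qu {n : ℕ} (x : Delta n) (i : ℕ) : ℝ := ext x (n - 1 - i) - ext x (n - i)

section Coordinates

variable {n : ℕ} [NeZero n]

omit [NeZero n] in
theorem ext_of_lt (x : Delta n) (i : Fin n) : ext x i = x.1 i := by simp [ext]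

theorem ext_zero (x : Delta n) : ext x 0 = x.1 0 := by
  have := ext_of_lt x 0
  simpa using this

theorem ext_last (x : Delta n) : ext x (n - 1) = x.1 (lastIdx n) := ext_of_lt x (lastIdx n)

omit [NeZero n] in
theorem ext_end (x : Delta n) : ext x n = 0 := by simp [ext]

theorem qu_zero (x : Delta n) : qu x 0 = x.1 (lastIdx n) := by
  simp [qu, ext_last, ext_end]

theorem hd_nonneg (x : Delta n) : 0 ≤ hd x := by
  have := ((mem_Delta_iff x.1).1 x.2).1
  simp only [hd]; linarith

theorem qu_nonneg (x : Delta n) (i : ℕ) : 0 ≤ qu x i := by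
  obtain ⟨-, h2, h3⟩ := (mem_Delta_iff x.1).1 x.2
  have hn : 0 < n := Nat.pos_of_ne_zero (NeZero.ne n)
  unfold qu ext
  split_ifs with h h' h'
  · exact sub_nonneg.2 (h2 _ _ (by change n - 1 - i ≤ n - i; omega))
  · rw [sub_zero]; exact h3.trans (h2 _ _ (le_lastIdx _))
  · omega
  · simp

omit [NeZero n] in
theorem sum_qu (x : Delta n) {m : ℕ} (hm : m ≤ n) :
    ∑ i ∈ Finset.range m, qu x i = ext x (n - m) := by
  induction m with
  | zero => simp [ext_end]
  | succ m ih =>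
    rw [Finset.sum_range_succ, ih (by omega), qu, show n - 1 - m = n - (m + 1) by omega]
    ring

omit [NeZero n] in
theorem coord_eq_sum (x : Delta n) (i : Fin n) :
    x.1 i = ∑ k ∈ Finset.range (n - i), qu x k := by
  rw [sum_qu x (Nat.sub_le _ _), ← ext_of_lt, Nat.sub_sub_self i.2.le]

theorem hd_add_sum (x : Delta n) : hd x + ∑ i ∈ Finset.range n, qu x i = 1 := by
  rw [sum_qu x le_rfl, Nat.sub_self, ext_zero, hd]; ring

omit [NeZero n] in
theorem ext_of_qu {x y : Delta n} (h : ∀ i < n, qu x i = qu y i) : x = y := by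
  apply Subtype.ext
  funext i
  rw [coord_eq_sum, coord_eq_sum]
  refine Finset.sum_congr rfl fun k hk => h k ?_
  have := Finset.mem_range.1 hk
  omega

/-- Every probability vector is the vector of barycentric coordinates of a point of `Δ`. -/
theorem exists_point {a : ℝ} {b : ℕ → ℝ} (ha : 0 ≤ a) (hb : ∀ i < n, 0 ≤ b i)
    (hs : a + ∑ i ∈ Finset.range n, b i = 1) :
    ∃ x : Delta n, hd x = a ∧ ∀ i < n, qu x i = b i := by
  have hn : 0 < n := Nat.pos_of_ne_zero (NeZero.ne n)
  let y : Fin n → ℝ := fun i => ∑ k ∈ Finset.range (n - i), b k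
  have hy0 : y 0 = 1 - a := by simp only [y, Fin.val_zero, Nat.sub_zero]; linarith
  have hy : y ∈ Delta n := by
    rw [mem_Delta_iff]
    refine ⟨by linarith, ?_, ?_⟩
    · intro i j hij
      refine Finset.sum_le_sum_of_subset_of_nonneg ?_ ?_
      · have : (i : ℕ) ≤ j := hij
        exact Finset.range_mono (by omega)
      · intro k hk _
        have := Finset.mem_range.1 hk
        exact hb k (by omega)
    · refine Finset.sum_nonneg fun k hk => hb k ?_
      have := Finset.mem_range.1 hk
      omega
  have hext : ∀ m ≤ n, ext (⟨y, hy⟩ : Delta n) (n - m) = ∑ k ∈ Finset.range m, b k := by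
    intro m hm
    unfold ext
    split_ifs with h
    · simp only [y, Nat.sub_sub_self hm]
    · have : m = 0 := by omega
      simp [this]
  refine ⟨⟨y, hy⟩, ?_, fun i hi => ?_⟩
  · change 1 - y 0 = a
    linarith
  · rw [qu, show n - 1 - i = n - (i + 1) by omega, hext _ (by omega), hext _ hi.le,
      Finset.sum_range_succ]
    ring

theorem qu_le_one (x : Delta n) {i : ℕ} (hi : i < n) : qu x i ≤ 1 := by
  have h := Finset.single_le_sum (f := qu x) (fun k _ => qu_nonneg x k) (Finset.mem_range.2 hi)
  linarith [hd_add_sum x, hd_nonneg x]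

/-- The difference of the barycentric coordinates at the two ends of the edge that is split: it is
nonnegative on `Δ₀`, nonpositive on `Δ₁`, and it vanishes on their common wall. -/
noncomputable def sgm (x : Delta n) : ℝ := hd x - qu x 0

theorem mem_half_false {x : Delta n} : x ∈ half n false ↔ 0 ≤ sgm x := by
  simp only [half, sgm, hd, qu_zero]
  constructor
  · intro h
    have : x.1 0 + x.1 (lastIdx n) ≤ 1 := by simpa using h
    linarith
  · intro h
    have : x.1 0 + x.1 (lastIdx n) ≤ 1 := by linarith
    simpa using this

theorem mem_half_true {x : Delta n} : x ∈ half n true ↔ sgm x ≤ 0 := by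
  simp only [half, sgm, hd, qu_zero]
  constructor
  · intro h
    have : 1 ≤ x.1 0 + x.1 (lastIdx n) := by simpa using h
    linarith
  · intro h
    have : 1 ≤ x.1 0 + x.1 (lastIdx n) := by linarith
    simpa using this

/-- The total mass of the image of the barycentric coordinates of `x` under the piecewise linear
map that is normalized to give the dynamics: see `IsModel`. -/
noncomputable def mass (κ : ℝ) (x : Delta n) : ℝ := 1 - (2 - κ) * min (hd x) (qu x 0)

/-- In barycentric coordinates `(μ₁, …, μ_{n+1})`, and up to the scalar factor `mass κ x`, the map
`f` is the piecewise linear map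
`(μ₁, …, μ_{n+1}) ↦ (|μ₁ - μ₂|, μ₃, …, μ_{n+1}, κ min(μ₁, μ₂))`.
This is the tent map for `κ = 2`, where the factor is `1`, and the Mönkemeyer map for `κ = 1`. -/
structure IsModel (κ : ℝ) (f : Delta n → Delta n) : Prop where
  head : ∀ x, mass κ x * hd (f x) = |sgm x|
  shift : ∀ x i, i + 1 < n → mass κ x * qu (f x) i = qu x (i + 1)
  push : ∀ x, mass κ x * qu (f x) (n - 1) = κ * min (hd x) (qu x 0)

theorem hd_add_qu_le (x : Delta n) : hd x + qu x 0 ≤ 1 := by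
  have hn : 0 < n := Nat.pos_of_ne_zero (NeZero.ne n)
  have h := Finset.single_le_sum (f := qu x) (fun k _ => qu_nonneg x k) (Finset.mem_range.2 hn)
  linarith [hd_add_sum x]

theorem mass_pos {κ : ℝ} (hκ : κ = 1 ∨ κ = 2) (x : Delta n) : 0 < mass κ x := by
  have h := hd_add_qu_le x
  have h1 := min_le_left (hd x) (qu x 0)
  have h2 := min_le_right (hd x) (qu x 0)
  rcases hκ with rfl | rfl <;> simp only [mass] <;> linarith

theorem isModel_of_coords {κ : ℝ} {f : Delta n → Delta n}
    (h0 : ∀ x : Delta n, mass κ x * (f x).1 0 = mass κ x - |sgm x|)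
    (hs : ∀ (x : Delta n) (i : Fin n), i ≠ 0 →
      mass κ x * (f x).1 i = x.1 (prevIdx i) - x.1 (lastIdx n))
    (hp : ∀ x : Delta n,
      mass κ x - |sgm x| - (x.1 0 - x.1 (lastIdx n)) = κ * min (hd x) (qu x 0)) :
    IsModel κ f := by
  have hn : 0 < n := Nat.pos_of_ne_zero (NeZero.ne n)
  have key : ∀ x j, j < n → mass κ x * ext (f x) (j + 1) = ext x j - x.1 (lastIdx n) := by
    intro x j hj
    by_cases hj' : j + 1 < n
    · have e := hs x ⟨j + 1, hj'⟩ (by intro h; have := congrArg Fin.val h; simp at this)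
      have e1 : ext (f x) (j + 1) = (f x).1 ⟨j + 1, hj'⟩ := ext_of_lt (f x) ⟨j + 1, hj'⟩
      rw [e1, e]
      have : prevIdx (⟨j + 1, hj'⟩ : Fin n) = ⟨j, hj⟩ := Fin.ext (by simp [prevIdx])
      rw [this, ← ext_of_lt]
    · have : j = n - 1 := by omega
      have e2 : j + 1 = n := by omega
      rw [e2, ext_end, this, ext_last]
      ring
  refine ⟨fun x => ?_, fun x i hi => ?_, fun x => ?_⟩
  · have := h0 x
    simp only [hd]; linarith
  · rw [qu, qu, mul_sub, show n - 1 - i = (n - 1 - (i + 1)) + 1 by omega, key x _ (by omega),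
      show n - i = (n - (i + 1)) + 1 by omega, key x _ (by omega)]
    ring
  · rw [qu, mul_sub, Nat.sub_self, show n - (n - 1) = 0 + 1 by omega, key x 0 hn, ext_zero,
      ext_zero, h0, ← hp]

theorem isModel_M : IsModel 1 (M n) := by
  have hm : ∀ x : Delta n, mass 1 x =
      if x.1 0 + x.1 (lastIdx n) ≤ 1 then 1 - x.1 (lastIdx n) else x.1 0 := by
    intro x
    simp only [mass, hd, qu_zero]
    split_ifs with h
    · rw [min_eq_right (by linarith)]; ring
    · rw [min_eq_left (by linarith)]; ring
  refine isModel_of_coords (fun x => ?_) (fun x i hi => ?_) (fun x => ?_)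
  · have hpos := mass_pos (Or.inl rfl) x
    rw [hm] at hpos ⊢
    simp only [M, monkemeyerFun, sgm, hd, qu_zero, if_true]
    split_ifs at hpos ⊢ with h
    · rw [abs_of_nonneg (by linarith)]; field_simp; ring
    · rw [abs_of_nonpos (by linarith)]; field_simp; ring
  · have hpos := mass_pos (Or.inl rfl) x
    rw [hm] at hpos ⊢
    simp only [M, monkemeyerFun, if_neg hi]
    split_ifs at hpos ⊢ with h <;> field_simp
  · rw [hm]
    simp only [sgm, hd, qu_zero]
    split_ifs with h
    · rw [abs_of_nonneg (by linarith), min_eq_right (by linarith)]; ring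
    · rw [abs_of_nonpos (by linarith), min_eq_left (by linarith)]; ring

theorem isModel_T : IsModel 2 (T n) := by
  have hm : ∀ x : Delta n, mass 2 x = 1 := fun x => by simp [mass]
  refine isModel_of_coords (fun x => ?_) (fun x i hi => ?_) (fun x => ?_)
  · rw [hm]
    simp only [T, tentFun, sgm, hd, qu_zero, if_true]
    split_ifs with h
    · rw [abs_of_nonneg (by linarith)]; ring
    · rw [abs_of_nonpos (by linarith)]; ring
  · rw [hm]
    simp only [T, tentFun, if_neg hi]
    split_ifs with h <;> ring
  · rw [hm]
    simp only [sgm, hd, qu_zero]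
    rcases le_total (x.1 0 + x.1 (lastIdx n)) 1 with h | h
    · rw [abs_of_nonneg (by linarith), min_eq_right (by linarith)]; ring
    · rw [abs_of_nonpos (by linarith), min_eq_left (by linarith)]; ring

end Coordinates

/-! ### Queues -/

/-- A machine with a head `H t` and a queue `G t, …, G (t + n - 1)` at time `t`. At each step the
element `op (H t) (G t)` enters the queue, the front `G t` leaves it, and the digit `w t` decides
whether the front replaces the head. -/
structure IsQueue {α : Type*} (n : ℕ) (w : ℕ → Bool) (op : α → α → α) (H G : ℕ → α) : Prop where
  head : ∀ t, H (t + 1) = if w t then G t else H t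
  push : ∀ t, G (t + n) = op (H t) (G t)

namespace IsQueue

variable {α : Type*} {n : ℕ} {w : ℕ → Bool} {op : α → α → α} {H G : ℕ → α}

theorem drop (h : IsQueue n w op H G) (s : ℕ) :
    IsQueue n (fun t => w (s + t)) op (fun t => H (s + t)) (fun t => G (s + t)) :=
  ⟨fun t => h.head (s + t), fun t => by have := h.push (s + t); rwa [add_assoc] at this⟩

end IsQueue

/-- The head and the front of the queue with given initial data, as functions of the time. -/
def queueRun {α : Type*} (n : ℕ) [NeZero n] (w : ℕ → Bool) (op : α → α → α) (a : α) (b : ℕ → α) :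
    ℕ → α × α
  | t =>
    (if t = 0 then a
      else if w (t - 1) then (queueRun n w op a b (t - 1)).2 else (queueRun n w op a b (t - 1)).1,
     if _h : t < n then b t
      else op (queueRun n w op a b (t - n)).1 (queueRun n w op a b (t - n)).2)
  termination_by t => t
  decreasing_by
    all_goals first
      | omega
      | (have := Nat.pos_of_ne_zero (NeZero.ne n); omega)

theorem exists_isQueue {α : Type*} (n : ℕ) [NeZero n] (w : ℕ → Bool) (op : α → α → α) (a : α)
    (b : ℕ → α) : ∃ H G : ℕ → α, IsQueue n w op H G ∧ H 0 = a ∧ ∀ i < n, G i = b i := by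
  refine ⟨fun t => (queueRun n w op a b t).1, fun t => (queueRun n w op a b t).2,
    ⟨fun t => ?_, fun t => ?_⟩, ?_, fun i hi => ?_⟩
  · rw [queueRun]; simp
  · rw [queueRun]; simp
  · change (queueRun n w op a b 0).1 = a
    rw [queueRun]; simp
  · change (queueRun n w op a b i).2 = b i
    rw [queueRun]; simp [hi]

open Classical in
/-- The number of marked elements at time `t`, in the head and in the queue. -/
noncomputable def marks (n : ℕ) (P p : ℕ → Prop) (t : ℕ) : ℕ :=
  (if P t then 1 else 0) + ∑ i ∈ Finset.range n, if p (t + i) then 1 else 0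

theorem marks_eq_zero {n : ℕ} {P p : ℕ → Prop} {t : ℕ} :
    marks n P p t = 0 ↔ ¬ P t ∧ ∀ i < n, ¬ p (t + i) := by
  simp [marks]

open Classical in
theorem marks_succ {n : ℕ} {w : ℕ → Bool} {P p : ℕ → Prop} (h : IsQueue n w And P p) (t : ℕ) :
    marks n P p (t + 1) + (if (P t ∨ p t) ∧ ¬ P (t + 1) then 1 else 0) = marks n P p t := by
  have e : ∑ i ∈ Finset.range n, (if p (t + 1 + i) then 1 else 0) + (if p t then 1 else 0)
      = ∑ i ∈ Finset.range n, (if p (t + i) then 1 else 0) + (if p (t + n) then 1 else 0) := by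
    rw [← Finset.sum_range_succ (fun i => if p (t + i) then 1 else 0), Finset.sum_range_succ']
    simp [add_assoc, add_comm 1]
  have e1 := h.head t
  have e2 := h.push t
  unfold marks
  rw [e2] at e
  rw [e1]
  by_cases hw : w t = true <;> by_cases h1 : P t <;> by_cases h2 : p t <;>
    simp only [hw, h1, h2, if_true, if_false, and_true, or_true, not_true,
      not_false_eq_true, and_false, or_false, Bool.false_eq_true, and_self] at e ⊢ <;> omega

theorem marks_antitone {n : ℕ} {w : ℕ → Bool} {P p : ℕ → Prop} (h : IsQueue n w And P p) :
    Antitone (marks n P p) :=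
  antitone_nat_of_succ_le fun t => by have := marks_succ h t; omega

theorem marks_const {n : ℕ} {w : ℕ → Bool} {P p : ℕ → Prop} (h : IsQueue n w And P p) {t : ℕ}
    (he : marks n P p (t + 1) = marks n P p t) (ht : P t ∨ p t) : P (t + 1) := by
  by_contra hc
  have := marks_succ h t
  rw [if_pos ⟨ht, hc⟩] at this
  omega

/-- If the number of marks of two disjoint kinds is constant, then a marked head stays marked, and
it can never meet a mark of the other kind at the front of the queue. -/
theorem not_head_of_marks_const {n : ℕ} {w : ℕ → Bool} {P p Q q : ℕ → Prop}
    (hP : IsQueue n w And P p) (hQ : IsQueue n w And Q q) (hd : ∀ t, ¬ (P t ∧ Q t)) {s : ℕ}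
    (cP : ∀ t < n, marks n P p (s + t + 1) = marks n P p (s + t))
    (cQ : ∀ t < n, marks n Q q (s + t + 1) = marks n Q q (s + t))
    (hQ0 : marks n Q q s ≠ 0) : ¬ P s := by
  intro hs
  have stay : ∀ t ≤ n, P (s + t) := by
    intro t
    induction t with
    | zero => intro _; exact hs
    | succ t ih => intro ht; exact marks_const hP (cP t (by omega)) (Or.inl (ih (by omega)))
  have : ∃ i < n, q (s + i) := by
    by_contra hc
    push Not at hc
    exact hQ0 (marks_eq_zero.2 ⟨fun h => hd s ⟨hs, h⟩, hc⟩)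
  obtain ⟨i, hi, hqi⟩ := this
  exact hd (s + i + 1) ⟨stay (i + 1) (by omega), marks_const hQ (cQ i hi) (Or.inr hqi)⟩

theorem marks_drop {n : ℕ} {w : ℕ → Bool} {P p Q q : ℕ → Prop}
    (hP : IsQueue n w And P p) (hQ : IsQueue n w And Q q) (hd : ∀ t, ¬ (P t ∧ Q t)) (s : ℕ)
    (hP0 : marks n P p (s + (2 * n + 1)) ≠ 0) (hQ0 : marks n Q q (s + (2 * n + 1)) ≠ 0) :
    marks n P p (s + (2 * n + 1)) + marks n Q q (s + (2 * n + 1)) <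
      marks n P p s + marks n Q q s := by
  have aP := marks_antitone hP
  have aQ := marks_antitone hQ
  by_contra hc
  have bP := aP (show s ≤ s + (2 * n + 1) by omega)
  have bQ := aQ (show s ≤ s + (2 * n + 1) by omega)
  have cP : ∀ t ≤ 2 * n + 1, marks n P p (s + t) = marks n P p s := fun t ht => by
    have := aP (show s ≤ s + t by omega)
    have := aP (show s + t ≤ s + (2 * n + 1) by omega)
    omega
  have cQ : ∀ t ≤ 2 * n + 1, marks n Q q (s + t) = marks n Q q s := fun t ht => by
    have := aQ (show s ≤ s + t by omega)
    have := aQ (show s + t ≤ s + (2 * n + 1) by omega)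
    omega
  have nP : ∀ t ≤ n, ¬ P (s + t) := fun t ht =>
    not_head_of_marks_const hP hQ hd
      (fun u hu => by
        have e1 := cP (t + u + 1) (by omega)
        have e2 := cP (t + u) (by omega)
        rw [← add_assoc] at e2
        rw [← add_assoc, ← add_assoc] at e1
        rw [e1, e2])
      (fun u hu => by
        have e1 := cQ (t + u + 1) (by omega)
        have e2 := cQ (t + u) (by omega)
        rw [← add_assoc] at e2
        rw [← add_assoc, ← add_assoc] at e1
        rw [e1, e2])
      (by rw [cQ t (by omega), ← cQ (2 * n + 1) le_rfl]; exact hQ0)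
  have : ∃ i < n, p (s + i) := by
    by_contra hc
    push Not at hc
    refine hP0 ?_
    rw [cP _ le_rfl]
    exact marks_eq_zero.2 ⟨nP 0 (Nat.zero_le _), hc⟩
  obtain ⟨i, hi, hpi⟩ := this
  refine nP (i + 1) (by omega) (marks_const hP ?_ (Or.inr hpi))
  exact (cP (i + 1) (by omega)).trans (cP i (by omega)).symm

/-- Two disjoint kinds of marks cannot both survive for a long time. -/
theorem marks_extinct {n : ℕ} {w : ℕ → Bool} {P p Q q : ℕ → Prop}
    (hP : IsQueue n w And P p) (hQ : IsQueue n w And Q q) (hd : ∀ t, ¬ (P t ∧ Q t)) :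
    marks n P p ((2 * n + 2) * (2 * n + 1)) = 0 ∨ marks n Q q ((2 * n + 2) * (2 * n + 1)) = 0 := by
  by_contra hc
  push Not at hc
  have key : ∀ k ≤ 2 * n + 2,
      marks n P p (k * (2 * n + 1)) + marks n Q q (k * (2 * n + 1)) + k ≤ 2 * n + 2 := by
    intro k
    induction k with
    | zero =>
      intro _
      have b : ∀ (P p : ℕ → Prop), marks n P p 0 ≤ n + 1 := by
        intro P p
        classical
        have : ∑ i ∈ Finset.range n, (if p (0 + i) then 1 else 0) ≤ ∑ i ∈ Finset.range n, 1 :=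
          Finset.sum_le_sum fun i _ => by split_ifs <;> omega
        simp only [Finset.sum_const, Finset.card_range, smul_eq_mul, mul_one] at this
        unfold marks
        split_ifs <;> omega
      have := b P p
      have := b Q q
      simp only [zero_mul]
      omega
    | succ k ih =>
      intro hk
      have h1 := ih (by omega)
      have hle : (k + 1) * (2 * n + 1) ≤ (2 * n + 2) * (2 * n + 1) :=
        Nat.mul_le_mul_right _ hk
      have e : (k + 1) * (2 * n + 1) = k * (2 * n + 1) + (2 * n + 1) := by ring
      have aP := marks_antitone hP hle
      have aQ := marks_antitone hQ hle
      have := marks_drop hP hQ hd (k * (2 * n + 1)) (by rw [← e]; omega) (by rw [← e]; omega)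
      rw [← e] at this
      omega
  have := key (2 * n + 2) le_rfl
  omega

/-! ### The dual pair of linear recurrences -/

/-- The operation that forms the new vertex when a simplex is split: for `κ = 2` the midpoint, and
for `κ = 1`, in homogeneous coordinates, the mediant. -/
noncomputable def mix (κ x y : ℝ) : ℝ := (x + y) / κ

/-- The linear recurrence that barycentric coordinates (a head `h` and a queue `q`) obey along an
orbit with itinerary `w`. -/
structure IsPrimal (n : ℕ) (κ : ℝ) (w : ℕ → Bool) (h q : ℕ → ℝ) : Prop where
  head : ∀ t, h (t + 1) = if w t then q t - h t else h t - q t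
  push : ∀ t, q (t + n) = κ * if w t then h t else q t

theorem sum_window_succ (n t : ℕ) (g : ℕ → ℝ) :
    ∑ i ∈ Finset.range n, g (t + 1 + i) + g t = ∑ i ∈ Finset.range n, g (t + i) + g (t + n) := by
  rw [← Finset.sum_range_succ (fun i => g (t + i)), Finset.sum_range_succ']
  simp [add_assoc, add_comm 1]

/-- The two recurrences are dual to each other: a primal run gives the barycentric coordinates of a
fixed point in the simplexes whose vertices are listed by the queue. -/
theorem IsPrimal.pairing {n : ℕ} {κ : ℝ} (hκ : κ ≠ 0) {w : ℕ → Bool} {h q H G : ℕ → ℝ}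
    (hp : IsPrimal n κ w h q) (hd : IsQueue n w (mix κ) H G) (t : ℕ) :
    h t * H t + ∑ i ∈ Finset.range n, q (t + i) * G (t + i)
      = h 0 * H 0 + ∑ i ∈ Finset.range n, q i * G i := by
  induction t with
  | zero => simp
  | succ t ih =>
    rw [← ih]
    have e := sum_window_succ n t (fun i => q i * G i)
    have e1 := hp.head t
    have e2 := hp.push t
    have e3 := hd.head t
    have e4 : κ * G (t + n) = H t + G t := by rw [hd.push t, mix]; field_simp
    have e5 : q (t + n) * G (t + n) = (if w t then h t else q t) * (H t + G t) := by
      rw [← e4, e2]; ring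
    rw [e5] at e
    rw [e1, e3]
    split_ifs at e ⊢ <;> linarith

theorem IsQueue.combo {n : ℕ} {κ : ℝ} {w : ℕ → Bool} {H G H' G' : ℕ → ℝ}
    (h : IsQueue n w (mix κ) H G) (h' : IsQueue n w (mix κ) H' G') (a b : ℝ) :
    IsQueue n w (mix κ) (fun t => a * H t + b * H' t) (fun t => a * G t + b * G' t) := by
  refine ⟨fun t => ?_, fun t => ?_⟩
  · simp only [h.head t, h'.head t]
    split_ifs <;> rfl
  · simp only [h.push t, h'.push t, mix]
    ring

/-- All the elements present at time `t` are nonnegative. -/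
def NonnegAt (n : ℕ) (H G : ℕ → ℝ) (t : ℕ) : Prop := 0 ≤ H t ∧ ∀ i < n, 0 ≤ G (t + i)

theorem forall_window_succ {n t : ℕ} {R : ℕ → Prop} (h : ∀ i < n, R (t + i)) (hn : R (t + n)) :
    ∀ i < n, R (t + 1 + i) := by
  intro i hi
  rw [show t + 1 + i = t + (i + 1) by omega]
  rcases Nat.lt_or_ge (i + 1) n with h' | h'
  · exact h _ h'
  · rwa [show i + 1 = n by omega]

section Contraction

variable {n : ℕ} [NeZero n] {κ : ℝ} {w : ℕ → Bool} {H G : ℕ → ℝ}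

theorem NonnegAt.succ (hκ : 0 < κ) (h : IsQueue n w (mix κ) H G) {t : ℕ} (ht : NonnegAt n H G t) :
    NonnegAt n H G (t + 1) := by
  have hn : 0 < n := Nat.pos_of_ne_zero (NeZero.ne n)
  have h0 := ht.2 0 hn
  rw [add_zero] at h0
  refine ⟨?_, forall_window_succ (R := fun i => 0 ≤ G i) ht.2 ?_⟩
  · rw [h.head t]
    split_ifs
    exacts [h0, ht.1]
  · simp only [h.push t, mix]
    exact div_nonneg (add_nonneg ht.1 h0) hκ.le

theorem NonnegAt.mono (hκ : 0 < κ) (h : IsQueue n w (mix κ) H G) {s t : ℕ} (hst : s ≤ t)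
    (ht : NonnegAt n H G s) : NonnegAt n H G t := by
  induction t, hst using Nat.le_induction with
  | base => exact ht
  | succ t _ ih => exact ih.succ hκ h

/-- An element is marked only if all its ancestors at time `0` are marked; so an unmarked element has
an unmarked ancestor, whose contribution bounds it from below. -/
theorem lower_bound_of_unmarked (hκ : 0 < κ) (hκ2 : κ ≤ 2) (h : IsQueue n w (mix κ) H G)
    (h0 : NonnegAt n H G 0) {P p : ℕ → Prop} (hP : IsQueue n w And P p) {c : ℝ} (hc : 0 ≤ c)
    (hc0 : ¬ P 0 → c ≤ H 0) (hci : ∀ i < n, ¬ p i → c ≤ G i) (t : ℕ) :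
    (¬ P t → c / 2 ^ t ≤ H t) ∧ ∀ i < n, ¬ p (t + i) → c / 2 ^ t ≤ G (t + i) := by
  have hn : 0 < n := Nat.pos_of_ne_zero (NeZero.ne n)
  induction t with
  | zero => simpa using ⟨hc0, hci⟩
  | succ t ih =>
    obtain ⟨ih1, ih2⟩ := ih
    have hnn := NonnegAt.mono hκ h (Nat.zero_le t) h0
    have g0 := hnn.2 0 hn
    have ih0 := ih2 0 hn
    rw [add_zero] at ih0 g0
    have hle : c / 2 ^ (t + 1) ≤ c / 2 ^ t :=
      div_le_div_of_nonneg_left hc (by positivity) (pow_le_pow_right₀ one_le_two (Nat.le_succ t))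
    refine ⟨?_, forall_window_succ (R := fun i => ¬ p i → c / 2 ^ (t + 1) ≤ G i)
      (fun i hi hpi => hle.trans (ih2 i hi hpi)) ?_⟩
    · rw [h.head t, hP.head t]
      split_ifs
      exacts [fun hp => hle.trans (ih0 hp), fun hp => hle.trans (ih1 hp)]
    · intro hp
      rw [hP.push t, not_and_or] at hp
      have hsum : c / 2 ^ t ≤ H t + G t := by
        rcases hp with hp | hp
        · linarith [ih1 hp]
        · linarith [ih0 hp, hnn.1]
      have e : c / 2 ^ (t + 1) = c / 2 ^ t / 2 := by rw [pow_succ]; field_simp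
      rw [h.push t, mix, e]
      have := hnn.1
      exact (div_le_div_of_nonneg_right hsum two_pos.le).trans
        (div_le_div_of_nonneg_left (by linarith) hκ hκ2)

theorem upper_bound (hκ : 1 ≤ κ) (h : IsQueue n w (mix κ) H G)
    (h0 : NonnegAt n H G 0) {b : ℝ} (hb0 : H 0 ≤ b) (hbi : ∀ i < n, G i ≤ b) (t : ℕ) :
    H t ≤ b * 2 ^ t ∧ ∀ i < n, G (t + i) ≤ b * 2 ^ t := by
  have hn : 0 < n := Nat.pos_of_ne_zero (NeZero.ne n)
  have hb : 0 ≤ b := h0.1.trans hb0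
  induction t with
  | zero => simpa using ⟨hb0, hbi⟩
  | succ t ih =>
    obtain ⟨ih1, ih2⟩ := ih
    have hnn := NonnegAt.mono (zero_lt_one.trans_le hκ) h (Nat.zero_le t) h0
    have g0 := hnn.2 0 hn
    have ih0 := ih2 0 hn
    rw [add_zero] at ih0 g0
    have hle : b * 2 ^ t ≤ b * 2 ^ (t + 1) :=
      mul_le_mul_of_nonneg_left (pow_le_pow_right₀ one_le_two (Nat.le_succ t)) hb
    refine ⟨?_, forall_window_succ (R := fun i => G i ≤ b * 2 ^ (t + 1))
      (fun i hi => (ih2 i hi).trans hle) ?_⟩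
    · rw [h.head t]
      split_ifs
      exacts [ih0.trans hle, ih1.trans hle]
    · simp only [h.push t, mix]
      have := hnn.1
      refine (div_le_self (by linarith) hκ).trans ?_
      rw [pow_succ]
      linarith

/-- The number of steps after which a bracket has shrunk, as given by `marks_extinct`. -/
def shrinkTime (n : ℕ) : ℕ := (2 * n + 2) * (2 * n + 1)

/-- The quotients of the elements of the run `(L, l)` by those of `(D, d)` lie in `[lo, hi]` at
time `t`. -/
def Bracket (n : ℕ) (D d L l : ℕ → ℝ) (lo hi : ℝ) (t : ℕ) : Prop :=
  NonnegAt n (fun s => hi * D s + -1 * L s) (fun s => hi * d s + -1 * l s) t ∧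
    NonnegAt n (fun s => 1 * L s + -lo * D s) (fun s => 1 * l s + -lo * d s) t

variable {D d L l : ℕ → ℝ}

theorem Bracket.mono (hκ : 0 < κ) (hD : IsQueue n w (mix κ) D d) (hL : IsQueue n w (mix κ) L l)
    {lo hi : ℝ} {s t : ℕ} (hst : s ≤ t) (h : Bracket n D d L l lo hi s) :
    Bracket n D d L l lo hi t :=
  ⟨NonnegAt.mono hκ (hD.combo hL hi (-1)) hst h.1, NonnegAt.mono hκ (hL.combo hD 1 (-lo)) hst h.2⟩

/-- If the weights `D` are comparable at some time, then, a bounded number of steps later, every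
element has inherited a definite proportion of the large initial quotients, or every element has
inherited a definite proportion of the small ones. In both cases the bracket has shrunk. -/
theorem Bracket.contract_zero (hκ : 1 ≤ κ) (hκ2 : κ ≤ 2) (hD : IsQueue n w (mix κ) D d)
    (hL : IsQueue n w (mix κ) L l) {δ : ℝ} (hδ : 0 < δ) (hD0 : δ ≤ D 0 ∧ D 0 ≤ 2 * δ)
    (hd0 : ∀ i < n, δ ≤ d i ∧ d i ≤ 2 * δ) {lo hi : ℝ} (hlh : lo ≤ hi)
    (h : Bracket n D d L l lo hi 0) :
    ∃ lo' hi', hi' - lo' = (1 - 1 / 4 ^ (shrinkTime n + 1)) * (hi - lo) ∧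
      Bracket n D d L l lo' hi' (shrinkTime n) := by
  have hκ0 : 0 < κ := zero_lt_one.trans_le hκ
  obtain ⟨P, p, hP, hP0, hp0⟩ := exists_isQueue n w And ((lo + hi) / 2 * D 0 < L 0)
    (fun i => (lo + hi) / 2 * d i < l i)
  obtain ⟨Q, q, hQ, hQ0, hq0⟩ := exists_isQueue n w And (¬ (lo + hi) / 2 * D 0 < L 0)
    (fun i => ¬ (lo + hi) / 2 * d i < l i)
  have hn : 0 < n := Nat.pos_of_ne_zero (NeZero.ne n)
  have hdisj : ∀ t, ¬ (P t ∧ Q t) ∧ ∀ i < n, ¬ (p (t + i) ∧ q (t + i)) := by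
    intro t
    induction t with
    | zero =>
      refine ⟨by rw [hP0, hQ0]; tauto, fun i hi => ?_⟩
      rw [zero_add, hp0 i hi, hq0 i hi]; tauto
    | succ t ih =>
      obtain ⟨ih1, ih2⟩ := ih
      have ih0 := ih2 0 hn
      rw [add_zero] at ih0
      refine ⟨?_, forall_window_succ (R := fun i => ¬ (p i ∧ q i)) ih2 ?_⟩
      · rw [hP.head t, hQ.head t]
        split_ifs
        exacts [ih0, ih1]
      · rw [hP.push t, hQ.push t]; tauto
  have hnn : NonnegAt n D d 0 :=
    ⟨hδ.le.trans hD0.1, fun i hi => by rw [zero_add]; exact hδ.le.trans (hd0 i hi).1⟩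
  obtain ⟨ub1, ub2⟩ := upper_bound hκ hD hnn hD0.2 (fun i hi => (hd0 i hi).2) (shrinkTime n)
  have hc : 0 ≤ (hi - lo) / 2 * δ := mul_nonneg (by linarith) hδ.le
  -- After `t` steps the weights are at most `2δ * 2 ^ t`, and elements without a mark have inherited
  -- a slack of at least `δ(hi - lo)/2 / 2 ^ t` at one end of the bracket.
  have gain : ∀ x : ℝ, x ≤ 2 * δ * 2 ^ shrinkTime n →
      1 / 4 ^ (shrinkTime n + 1) * (hi - lo) * x ≤ (hi - lo) / 2 * δ / 2 ^ shrinkTime n := by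
    intro x hx
    have h1 : 1 / 4 ^ (shrinkTime n + 1) * (hi - lo) * x ≤
        1 / 4 ^ (shrinkTime n + 1) * (hi - lo) * (2 * δ * 2 ^ shrinkTime n) :=
      mul_le_mul_of_nonneg_left hx (mul_nonneg (by positivity) (by linarith))
    refine h1.trans (le_of_eq ?_)
    have : (4 : ℝ) ^ (shrinkTime n + 1) = 4 * (2 ^ shrinkTime n * 2 ^ shrinkTime n) := by
      rw [pow_succ, ← mul_pow]; norm_num [mul_comm]
    rw [this]
    field_simp
    ring
  have hmono := Bracket.mono hκ0 hD hL (Nat.zero_le (shrinkTime n)) h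
  rcases marks_extinct hP hQ (fun t => (hdisj t).1) with hm | hm
  · obtain ⟨m1, m2⟩ := marks_eq_zero.1 hm
    obtain ⟨b1, b2⟩ := lower_bound_of_unmarked hκ0 hκ2 (hD.combo hL hi (-1)) h.1 hP hc
      (fun hh => by
        rw [hP0] at hh
        nlinarith [mul_le_mul_of_nonneg_left hD0.1 (show (0:ℝ) ≤ (hi - lo) / 2 by linarith)])
      (fun i hi' hh => by
        rw [hp0 i hi'] at hh
        nlinarith [mul_le_mul_of_nonneg_left (hd0 i hi').1
          (show (0:ℝ) ≤ (hi - lo) / 2 by linarith)]) (shrinkTime n)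
    refine ⟨lo, hi - 1 / 4 ^ (shrinkTime n + 1) * (hi - lo), by ring, ⟨?_, ?_⟩, hmono.2⟩
    · have := b1 m1
      have := gain _ ub1
      simp only at *
      linarith
    · intro i hi'
      have := b2 i hi' (m2 i hi')
      have := gain _ (ub2 i hi')
      simp only at *
      linarith
  · obtain ⟨m1, m2⟩ := marks_eq_zero.1 hm
    obtain ⟨b1, b2⟩ := lower_bound_of_unmarked hκ0 hκ2 (hL.combo hD 1 (-lo)) h.2 hQ hc
      (fun hh => by
        rw [hQ0, not_not] at hh
        nlinarith [mul_le_mul_of_nonneg_left hD0.1 (show (0:ℝ) ≤ (hi - lo) / 2 by linarith)])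
      (fun i hi' hh => by
        rw [hq0 i hi', not_not] at hh
        nlinarith [mul_le_mul_of_nonneg_left (hd0 i hi').1
          (show (0:ℝ) ≤ (hi - lo) / 2 by linarith)]) (shrinkTime n)
    refine ⟨lo + 1 / 4 ^ (shrinkTime n + 1) * (hi - lo), hi, by ring, hmono.1, ⟨?_, ?_⟩⟩
    · have := b1 m1
      have := gain _ ub1
      simp only at *
      linarith
    · intro i hi'
      have := b2 i hi' (m2 i hi')
      have := gain _ (ub2 i hi')
      simp only at *
      linarith

theorem Bracket.contract (hκ : 1 ≤ κ) (hκ2 : κ ≤ 2) (hD : IsQueue n w (mix κ) D d)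
    (hL : IsQueue n w (mix κ) L l) {s : ℕ} {δ : ℝ} (hδ : 0 < δ) (hD0 : δ ≤ D s ∧ D s ≤ 2 * δ)
    (hd0 : ∀ i < n, δ ≤ d (s + i) ∧ d (s + i) ≤ 2 * δ) {lo hi : ℝ} (hlh : lo ≤ hi)
    (h : Bracket n D d L l lo hi s) :
    ∃ lo' hi', hi' - lo' = (1 - 1 / 4 ^ (shrinkTime n + 1)) * (hi - lo) ∧
      Bracket n D d L l lo' hi' (s + shrinkTime n) := by
  obtain ⟨lo', hi', h1, h2⟩ := Bracket.contract_zero hκ hκ2 (hD.drop s) (hL.drop s) hδ hD0 hd0 hlh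
    (by simpa [Bracket, NonnegAt] using h)
  exact ⟨lo', hi', h1, by simpa [Bracket, NonnegAt, add_assoc] using h2⟩

/-- The weights are comparable after every step at which the head changes: for `κ = 2` all the
weights are `1`, and for `κ = 1` the weights in the queue increase, the front being at least the
head. -/
theorem weights_comparable (hκ : κ = 1 ∨ κ = 2) (hD : IsQueue n w (mix κ) D d) (hD0 : D 0 = 1)
    (hd0 : ∀ i < n, d i = 1) {t : ℕ} (hw : w t = true) :
    ∃ δ, 0 < δ ∧ (δ ≤ D (t + 1) ∧ D (t + 1) ≤ 2 * δ) ∧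
      ∀ i < n, δ ≤ d (t + 1 + i) ∧ d (t + 1 + i) ≤ 2 * δ := by
  have hn : 0 < n := Nat.pos_of_ne_zero (NeZero.ne n)
  rcases hκ with rfl | rfl
  · have hpush : ∀ t, d (t + n) = D t + d t := fun t => by rw [hD.push t, mix, div_one]
    have inv : ∀ t, 0 < D t ∧ D t ≤ d t ∧ ∀ i < n, d (t + i) ≤ d (t + 1 + i) := by
      intro t
      induction t with
      | zero =>
        refine ⟨by rw [hD0]; norm_num, by rw [hD0, hd0 0 hn], fun i hi => ?_⟩
        rw [zero_add, zero_add, hd0 i hi, add_comm 1 i]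
        rcases Nat.lt_or_ge (i + 1) n with h | h
        · rw [hd0 _ h]
        · rw [show i + 1 = 0 + n by omega, hpush, hD0, hd0 0 hn]; norm_num
      | succ t ih =>
        obtain ⟨ih1, ih2, ih3⟩ := ih
        have h0 := ih3 0 hn
        rw [add_zero, add_zero] at h0
        have ih3' : ∀ i < n, d (t + 1 + i) ≤ d (1 + (t + 1 + i)) := by
          refine forall_window_succ (R := fun i => d i ≤ d (1 + i)) (t := t) (fun i hi => ?_) ?_
          · rw [show 1 + (t + i) = t + 1 + i by ring]; exact ih3 i hi
          · rw [show 1 + (t + n) = t + 1 + n by ring, hpush, hpush, hD.head t]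
            split_ifs <;> linarith
        refine ⟨?_, ?_, fun i hi => ?_⟩
        · rw [hD.head t]; split_ifs <;> linarith
        · rw [hD.head t]; split_ifs <;> linarith
        · rw [show t + 1 + 1 + i = 1 + (t + 1 + i) by ring]; exact ih3' i hi
    have mono : Monotone d := monotone_nat_of_le_succ fun s => by
      have := (inv s).2.2 0 hn
      simpa using this
    obtain ⟨i1, i2, -⟩ := inv t
    refine ⟨d t, by linarith, ?_, fun i hi => ⟨mono (by omega), ?_⟩⟩
    · rw [hD.head t, if_pos hw]
      constructor <;> linarith
    · have := mono (show t + 1 + i ≤ t + n by omega)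
      rw [hpush] at this
      linarith
  · have inv : ∀ t, D t = 1 ∧ ∀ i < n, d (t + i) = 1 := by
      intro t
      induction t with
      | zero => simpa using ⟨hD0, hd0⟩
      | succ t ih =>
        obtain ⟨ih1, ih2⟩ := ih
        have h0 := ih2 0 hn
        rw [add_zero] at h0
        refine ⟨?_, forall_window_succ (R := fun i => d i = 1) ih2 ?_⟩
        · rw [hD.head t, ih1, h0, ite_self]
        · simp only [hD.push t, mix, ih1, h0]; norm_num
    obtain ⟨i1, i2⟩ := inv (t + 1)
    refine ⟨1, one_pos, ?_, fun i hi => ?_⟩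
    · rw [i1]; norm_num
    · rw [i2 i hi]; norm_num

theorem exists_small_bracket (hκ : κ = 1 ∨ κ = 2) (hD : IsQueue n w (mix κ) D d)
    (hL : IsQueue n w (mix κ) L l) (hD0 : D 0 = 1) (hd0 : ∀ i < n, d i = 1)
    (hw : ∀ t, ∃ s ≥ t, w s = true) (h0 : Bracket n D d L l 0 1 0) (k : ℕ) :
    ∃ t lo hi, hi - lo = (1 - 1 / 4 ^ (shrinkTime n + 1)) ^ k ∧ Bracket n D d L l lo hi t := by
  have hκ1 : 1 ≤ κ := by rcases hκ with rfl | rfl <;> norm_num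
  have hκ2 : κ ≤ 2 := by rcases hκ with rfl | rfl <;> norm_num
  have hθ : (0 : ℝ) ≤ 1 - 1 / 4 ^ (shrinkTime n + 1) := by
    rw [sub_nonneg, div_le_one (by positivity)]
    exact one_le_pow₀ (by norm_num)
  induction k with
  | zero => exact ⟨0, 0, 1, by simp, h0⟩
  | succ k ih =>
    obtain ⟨t, lo, hi, e, hb⟩ := ih
    obtain ⟨s, hs, hws⟩ := hw t
    obtain ⟨δ, hδ, b1, b2⟩ := weights_comparable hκ hD hD0 hd0 hws
    have hlh : lo ≤ hi := by
      have := pow_nonneg hθ k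
      linarith
    obtain ⟨lo', hi', e', hb'⟩ := Bracket.contract hκ1 hκ2 hD hL hδ b1 b2 hlh
      (Bracket.mono (zero_lt_one.trans_le hκ1) hD hL (show t ≤ s + 1 by omega) hb)
    exact ⟨_, lo', hi', by rw [e', e, pow_succ]; ring, hb'⟩

end Contraction

/-! ### An itinerary determines its point -/

section Generation

variable {n : ℕ} [NeZero n] {κ : ℝ} {w : ℕ → Bool} {h q h' q' D d L l : ℕ → ℝ}

/-- If the head is no longer replaced, the elements of the queue do not decrease, but their sum over
all times is bounded by the head. -/
theorem IsPrimal.queue_eq_zero (hκ : 1 ≤ κ) (hp : IsPrimal n κ w h q) (h0 : ∀ t, 0 ≤ h t)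
    (q0 : ∀ t, 0 ≤ q t) {s : ℕ} (hw : ∀ t ≥ s, w t = false) {t : ℕ} (ht : s ≤ t) : q t = 0 := by
  have hn : 0 < n := Nat.pos_of_ne_zero (NeZero.ne n)
  have eh : ∀ u ≥ s, h (u + 1) = h u - q u := fun u hu => by rw [hp.head u, hw u hu]; simp
  have eq : ∀ u ≥ s, q u ≤ q (u + n) := fun u hu => by
    rw [hp.push u, hw u hu]
    have := mul_le_mul_of_nonneg_right hκ (q0 u)
    simpa using this
  have anti : ∀ k u, s ≤ u → h (u + k) ≤ h u := by
    intro k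
    induction k with
    | zero => intro u _; simp
    | succ k ih =>
      intro u hu
      have := ih u hu
      have := eh (u + k) (by omega)
      have := q0 (u + k)
      rw [← add_assoc]
      linarith
  have low : ∀ j : ℕ, q t ≤ q (t + j * n) ∧ h (t + j * n) ≤ h t - j * q t := by
    intro j
    induction j with
    | zero => simp
    | succ j ih =>
      obtain ⟨ih1, ih2⟩ := ih
      have e : t + (j + 1) * n = t + j * n + n := by ring
      have hs : s ≤ t + j * n := by omega
      rw [e]
      refine ⟨ih1.trans (eq _ hs), ?_⟩
      have a := anti (n - 1) (t + j * n + 1) (by omega)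
      rw [show t + j * n + 1 + (n - 1) = t + j * n + n by omega, eh _ hs] at a
      push_cast
      linarith
  by_contra hne
  have hpos : 0 < q t := lt_of_le_of_ne (q0 t) (Ne.symm hne)
  obtain ⟨j, hj⟩ := exists_nat_gt (h t / q t)
  rw [div_lt_iff₀ hpos] at hj
  linarith [(low j).2, h0 (t + j * n)]

omit [NeZero n] in
theorem IsPrimal.pairing_nonneg (hκ : κ ≠ 0) (hp : IsPrimal n κ w h q) (h0 : ∀ t, 0 ≤ h t)
    (q0 : ∀ t, 0 ≤ q t) (hd : IsQueue n w (mix κ) D d) {t : ℕ} (hn : NonnegAt n D d t) :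
    0 ≤ h 0 * D 0 + ∑ i ∈ Finset.range n, q i * d i := by
  rw [← hp.pairing hκ hd t]
  exact add_nonneg (mul_nonneg (h0 t) hn.1) (Finset.sum_nonneg fun i hi =>
    mul_nonneg (q0 _) (hn.2 i (Finset.mem_range.1 hi)))

omit [NeZero n] in
theorem IsPrimal.pairing_mem (hκ : κ ≠ 0) (hp : IsPrimal n κ w h q) (h0 : ∀ t, 0 ≤ h t)
    (q0 : ∀ t, 0 ≤ q t) (hs : h 0 + ∑ i ∈ Finset.range n, q i = 1)
    (hD : IsQueue n w (mix κ) D d) (hL : IsQueue n w (mix κ) L l) (hD0 : D 0 = 1)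
    (hd0 : ∀ i < n, d i = 1) {lo hi : ℝ} {t : ℕ} (hb : Bracket n D d L l lo hi t) :
    h 0 * L 0 + ∑ i ∈ Finset.range n, q i * l i ∈ Set.Icc lo hi := by
  have h1 := hp.pairing_nonneg hκ h0 q0 (hD.combo hL hi (-1)) hb.1
  have h2 := hp.pairing_nonneg hκ h0 q0 (hL.combo hD 1 (-lo)) hb.2
  have e : ∑ i ∈ Finset.range n, q i * d i = ∑ i ∈ Finset.range n, q i :=
    Finset.sum_congr rfl fun i hi => by rw [hd0 i (Finset.mem_range.1 hi), mul_one]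
  have e1 : ∑ i ∈ Finset.range n, q i * (hi * d i + -1 * l i) =
      hi * ∑ i ∈ Finset.range n, q i - ∑ i ∈ Finset.range n, q i * l i := by
    rw [← e, Finset.mul_sum, ← Finset.sum_sub_distrib]
    exact Finset.sum_congr rfl fun i _ => by ring
  have e2 : ∑ i ∈ Finset.range n, q i * (1 * l i + -lo * d i) =
      ∑ i ∈ Finset.range n, q i * l i - lo * ∑ i ∈ Finset.range n, q i := by
    rw [← e, Finset.mul_sum, ← Finset.sum_sub_distrib]
    exact Finset.sum_congr rfl fun i _ => by ring
  simp only [e1, e2, hD0] at h1 h2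
  have hs' : ∑ i ∈ Finset.range n, q i = 1 - h 0 := by linarith
  rw [hs'] at h1 h2
  constructor <;> linarith

/-- A linear functional with values in `[0, 1]` at the vertices of `Δ` cannot distinguish two
nonnegative runs with the same itinerary and total mass `1`. -/
theorem IsPrimal.pairing_eq (hκ : κ = 1 ∨ κ = 2) (hp : IsPrimal n κ w h q) (h0 : ∀ t, 0 ≤ h t)
    (q0 : ∀ t, 0 ≤ q t) (hs : h 0 + ∑ i ∈ Finset.range n, q i = 1)
    (hp' : IsPrimal n κ w h' q') (h0' : ∀ t, 0 ≤ h' t)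
    (q0' : ∀ t, 0 ≤ q' t) (hs' : h' 0 + ∑ i ∈ Finset.range n, q' i = 1)
    {a : ℝ} {b : ℕ → ℝ} (ha : 0 ≤ a ∧ a ≤ 1) (hb : ∀ i, 0 ≤ b i ∧ b i ≤ 1) :
    h 0 * a + ∑ i ∈ Finset.range n, q i * b i = h' 0 * a + ∑ i ∈ Finset.range n, q' i * b i := by
  have hκ1 : 1 ≤ κ := by rcases hκ with rfl | rfl <;> norm_num
  have hκ0 : κ ≠ 0 := by positivity
  obtain ⟨D, d, hD, hD0, hd0⟩ := exists_isQueue n w (mix κ) 1 (fun _ => 1)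
  obtain ⟨L, l, hL, hL0, hl0⟩ := exists_isQueue n w (mix κ) a b
  have el : ∀ q : ℕ → ℝ, ∑ i ∈ Finset.range n, q i * b i = ∑ i ∈ Finset.range n, q i * l i :=
    fun q => Finset.sum_congr rfl fun i hi => by rw [hl0 i (Finset.mem_range.1 hi)]
  rw [el, el, ← hL0]
  by_cases hw : ∀ t, ∃ s ≥ t, w s = true
  · have hb0 : Bracket n D d L l 0 1 0 := by
      refine ⟨⟨?_, fun i hi => ?_⟩, ⟨?_, fun i hi => ?_⟩⟩
      · simp only [hD0, hL0]; linarith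
      · simp only [zero_add, hd0 i hi, hl0 i hi]; linarith [hb i]
      · simp only [hD0, hL0]; linarith
      · simp only [zero_add, hd0 i hi, hl0 i hi]; linarith [hb i]
    set θ : ℝ := 1 - 1 / 4 ^ (shrinkTime n + 1) with hθ
    have hθ0 : 0 ≤ θ := by
      rw [hθ, sub_nonneg, div_le_one (by positivity)]
      exact one_le_pow₀ (by norm_num)
    have hθ1 : θ < 1 := by
      rw [hθ]
      linarith [show (0 : ℝ) < 1 / 4 ^ (shrinkTime n + 1) by positivity]
    have bound : ∀ k : ℕ, |(h 0 * L 0 + ∑ i ∈ Finset.range n, q i * l i) -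
        (h' 0 * L 0 + ∑ i ∈ Finset.range n, q' i * l i)| ≤ θ ^ k := by
      intro k
      obtain ⟨t, lo, hi, e, hbr⟩ := exists_small_bracket hκ hD hL hD0 hd0 hw hb0 k
      have m1 := hp.pairing_mem hκ0 h0 q0 hs hD hL hD0 hd0 hbr
      have m2 := hp'.pairing_mem hκ0 h0' q0' hs' hD hL hD0 hd0 hbr
      rw [← hθ] at e
      rw [← e, abs_le]
      constructor <;> linarith [m1.1, m1.2, m2.1, m2.2]
    have := ge_of_tendsto' (tendsto_pow_atTop_nhds_zero_of_lt_one hθ0 hθ1) bound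
    exact sub_eq_zero.1 (abs_eq_zero.1 (le_antisymm this (abs_nonneg _)))
  · push Not at hw
    obtain ⟨s, hw⟩ := hw
    have hw : ∀ t ≥ s, w t = false := fun t ht => by simpa using hw t ht
    have red : ∀ {h q H G : ℕ → ℝ}, IsPrimal n κ w h q → (∀ t, 0 ≤ h t) → (∀ t, 0 ≤ q t) →
        IsQueue n w (mix κ) H G →
        h 0 * H 0 + ∑ i ∈ Finset.range n, q i * G i = h s * H s := by
      intro h q H G hp h0 q0 hH
      rw [← hp.pairing hκ0 hH s, Finset.sum_eq_zero, add_zero]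
      intro i _
      rw [hp.queue_eq_zero hκ1 h0 q0 hw (Nat.le_add_right s i), zero_mul]
    have one : ∀ {h q : ℕ → ℝ}, IsPrimal n κ w h q → (∀ t, 0 ≤ h t) → (∀ t, 0 ≤ q t) →
        h 0 + ∑ i ∈ Finset.range n, q i = 1 → h s * D s = 1 := by
      intro h q hp h0 q0 hs
      rw [← red hp h0 q0 hD, hD0, mul_one, ← hs]
      congr 1
      exact Finset.sum_congr rfl fun i hi => by rw [hd0 i (Finset.mem_range.1 hi), mul_one]
    have e1 := one hp h0 q0 hs
    have e2 := one hp' h0' q0' hs'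
    have hDne : D s ≠ 0 := fun hz => by rw [hz, mul_zero] at e1; exact one_ne_zero e1.symm
    rw [red hp h0 q0 hL, red hp' h0' q0' hL, mul_right_cancel₀ hDne (e1.trans e2.symm)]

/-- Two nonnegative primal runs with the same itinerary and the same total mass coincide: the
nested simplexes of an itinerary shrink to a point. -/
theorem IsPrimal.unique (hκ : κ = 1 ∨ κ = 2) (hp : IsPrimal n κ w h q) (h0 : ∀ t, 0 ≤ h t)
    (q0 : ∀ t, 0 ≤ q t) (hs : h 0 + ∑ i ∈ Finset.range n, q i = 1)
    (hp' : IsPrimal n κ w h' q') (h0' : ∀ t, 0 ≤ h' t)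
    (q0' : ∀ t, 0 ≤ q' t) (hs' : h' 0 + ∑ i ∈ Finset.range n, q' i = 1) :
    ∀ i < n, q i = q' i := by
  intro i hi
  have := IsPrimal.pairing_eq hκ hp h0 q0 hs hp' h0' q0' hs' (a := 0)
    (b := fun k => if k = i then 1 else 0) (by norm_num) (fun k => by split_ifs <;> norm_num)
  simpa [Finset.sum_ite_eq', hi] using this

end Generation

/-! ### Orbits in barycentric coordinates -/

section Orbits

variable {n : ℕ} [NeZero n] {κ : ℝ} {f : Delta n → Delta n}

/-- The factor by which the barycentric coordinates of `fᵗ(x)` have to be multiplied to give a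
primal run. -/
noncomputable def scale (κ : ℝ) (f : Delta n → Delta n) (x : Delta n) (t : ℕ) : ℝ :=
  ∏ i ∈ Finset.range t, mass κ (f^[i] x)

theorem scale_succ (x : Delta n) (t : ℕ) :
    scale κ f x (t + 1) = scale κ f x t * mass κ (f^[t] x) := Finset.prod_range_succ _ _

theorem scale_pos (hκ : κ = 1 ∨ κ = 2) (x : Delta n) (t : ℕ) : 0 < scale κ f x t :=
  Finset.prod_pos fun _ _ => mass_pos hκ _

theorem scale_two (x : Delta n) (t : ℕ) : scale 2 f x t = 1 := by simp [scale, mass]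

theorem scale_add (x : Delta n) (s t : ℕ) :
    scale κ f x (s + t) = scale κ f x s * scale κ f (f^[s] x) t := by
  rw [scale, Finset.prod_range_add, scale, scale]
  congr 1
  exact Finset.prod_congr rfl fun i _ => by rw [← Function.iterate_add_apply, add_comm]

/-- The head of the primal run of `x`. -/
noncomputable def runHead (κ : ℝ) (f : Delta n → Delta n) (x : Delta n) (t : ℕ) : ℝ :=
  scale κ f x t * hd (f^[t] x)

/-- The queue of the primal run of `x`. -/
noncomputable def runQueue (κ : ℝ) (f : Delta n → Delta n) (x : Delta n) (t : ℕ) : ℝ :=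
  scale κ f x t * qu (f^[t] x) 0

theorem runQueue_add (hf : IsModel κ f) (x : Delta n) {i : ℕ} (hi : i < n) (t : ℕ) :
    runQueue κ f x (t + i) = scale κ f x t * qu (f^[t] x) i := by
  induction i generalizing t with
  | zero => rfl
  | succ i ih =>
    rw [show t + (i + 1) = t + 1 + i by ring, ih (by omega), scale_succ, mul_assoc,
      Function.iterate_succ_apply', hf.shift _ _ hi]

theorem isPrimal_run (hf : IsModel κ f) (x : Delta n) {w : ℕ → Bool}
    (hw : ∀ t, f^[t] x ∈ half n (w t)) : IsPrimal n κ w (runHead κ f x) (runQueue κ f x) := by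
  have hn : 0 < n := Nat.pos_of_ne_zero (NeZero.ne n)
  refine ⟨fun t => ?_, fun t => ?_⟩
  · simp only [runHead, runQueue]
    rw [scale_succ, mul_assoc, Function.iterate_succ_apply', hf.head]
    have := hw t
    cases hwt : w t <;> rw [hwt] at this
    · rw [mem_half_false] at this
      rw [abs_of_nonneg this, sgm]; simp; ring
    · rw [mem_half_true] at this
      rw [abs_of_nonpos this, sgm]; simp; ring
  · rw [show t + n = t + 1 + (n - 1) by omega, runQueue_add hf _ (by omega), scale_succ, mul_assoc,
      Function.iterate_succ_apply', hf.push]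
    simp only [runHead, runQueue]
    have := hw t
    cases hwt : w t <;> rw [hwt] at this
    · rw [mem_half_false, sgm] at this
      rw [min_eq_right (by linarith)]; simp; ring
    · rw [mem_half_true, sgm] at this
      rw [min_eq_left (by linarith)]; simp; ring

theorem runHead_nonneg (hκ : κ = 1 ∨ κ = 2) (x : Delta n) (t : ℕ) : 0 ≤ runHead κ f x t :=
  mul_nonneg (scale_pos hκ x t).le (hd_nonneg _)

theorem runQueue_nonneg (hκ : κ = 1 ∨ κ = 2) (x : Delta n) (t : ℕ) : 0 ≤ runQueue κ f x t :=
  mul_nonneg (scale_pos hκ x t).le (qu_nonneg _ _)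

theorem runHead_zero (x : Delta n) : runHead κ f x 0 = hd x := by simp [runHead, scale]

theorem runQueue_of_lt (hf : IsModel κ f) (x : Delta n) {i : ℕ} (hi : i < n) :
    runQueue κ f x i = qu x i := by
  have := runQueue_add hf x hi 0
  rw [zero_add] at this
  rw [this]
  simp [scale]

theorem run_sum (hf : IsModel κ f) (x : Delta n) :
    runHead κ f x 0 + ∑ i ∈ Finset.range n, runQueue κ f x i = 1 := by
  rw [runHead_zero, ← hd_add_sum x]
  congr 1
  exact Finset.sum_congr rfl fun i hi => runQueue_of_lt hf x (Finset.mem_range.1 hi)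

/-- Points whose orbits never lie strictly on different sides of the wall are equal. -/
theorem eq_of_itinerary (hκ : κ = 1 ∨ κ = 2) (hf : IsModel κ f) {x y : Delta n}
    (h : ∀ t, 0 ≤ sgm (f^[t] x) * sgm (f^[t] y)) : x = y := by
  have key : ∀ t, ∃ a, f^[t] x ∈ half n a ∧ f^[t] y ∈ half n a := by
    intro t
    rcases mul_nonneg_iff.1 (h t) with ⟨h1, h2⟩ | ⟨h1, h2⟩
    · exact ⟨false, mem_half_false.2 h1, mem_half_false.2 h2⟩
    · exact ⟨true, mem_half_true.2 h1, mem_half_true.2 h2⟩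
  choose w hx hy using key
  refine ext_of_qu fun i hi => ?_
  rw [← runQueue_of_lt hf x hi, ← runQueue_of_lt hf y hi]
  exact IsPrimal.unique hκ (isPrimal_run hf x hx) (runHead_nonneg hκ x) (runQueue_nonneg hκ x)
    (run_sum hf x) (isPrimal_run hf y hy) (runHead_nonneg hκ y) (runQueue_nonneg hκ y)
    (run_sum hf y) i hi

end Orbits

/-! ### Inverse branches -/

section Branches

variable {n : ℕ} [NeZero n] {κ κ' : ℝ} {f g : Delta n → Delta n}

theorem sum_eq_pred_add (b : ℕ → ℝ) :
    ∑ i ∈ Finset.range n, b i = ∑ i ∈ Finset.range (n - 1), b i + b (n - 1) := by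
  have hn : 0 < n := Nat.pos_of_ne_zero (NeZero.ne n)
  rw [← Finset.sum_range_succ, Nat.sub_add_cancel hn]

theorem sum_eq_zero_add_pred (b : ℕ → ℝ) :
    ∑ i ∈ Finset.range n, b i = b 0 + ∑ i ∈ Finset.range (n - 1), b (i + 1) := by
  have hn : 0 < n := Nat.pos_of_ne_zero (NeZero.ne n)
  rw [add_comm, ← Finset.sum_range_succ' b, Nat.sub_add_cancel hn]

theorem eq_of_proportional {x y : Delta n} {a b : ℝ} (ha : a ≠ 0) (h : a * hd x = b * hd y)
    (hq : ∀ i < n, a * qu x i = b * qu y i) : a = b ∧ x = y := by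
  have e : a * ∑ i ∈ Finset.range n, qu x i = b * ∑ i ∈ Finset.range n, qu y i := by
    rw [Finset.mul_sum, Finset.mul_sum]
    exact Finset.sum_congr rfl fun i hi => hq i (Finset.mem_range.1 hi)
  have hx := hd_add_sum x
  have hy := hd_add_sum y
  have hab : a = b := by
    calc a = a * hd x + a * ∑ i ∈ Finset.range n, qu x i := by rw [← mul_add, hx, mul_one]
      _ = b * hd y + b * ∑ i ∈ Finset.range n, qu y i := by rw [h, e]
      _ = b := by rw [← mul_add, hy, mul_one]
  refine ⟨hab, ext_of_qu fun i hi => ?_⟩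
  have := hq i hi
  rw [← hab] at this
  exact mul_left_cancel₀ ha this

theorem kappa_pos (hκ : κ = 1 ∨ κ = 2) : 0 < κ := by rcases hκ with rfl | rfl <;> norm_num

/-- The barycentric coordinates of a point of a half of `Δ`, in terms of those of its image. -/
theorem IsModel.recover (hf : IsModel κ f) {x : Delta n} {a : Bool} (hx : x ∈ half n a) :
    κ * hd x = mass κ x * ((if a then 0 else κ * hd (f x)) + qu (f x) (n - 1)) ∧
    κ * qu x 0 = mass κ x * ((if a then κ * hd (f x) else 0) + qu (f x) (n - 1)) := by
  have h1 := hf.head x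
  have h2 := hf.push x
  have e : ∀ r, mass κ x * (κ * r) = κ * (mass κ x * r) := fun r => by ring
  cases a
  · rw [mem_half_false] at hx
    rw [abs_of_nonneg hx, sgm] at h1
    rw [sgm] at hx
    rw [min_eq_right (by linarith)] at h2
    simp only [Bool.false_eq_true, if_false, mul_add, zero_add, e, h1, h2]
    exact ⟨by ring, trivial⟩
  · rw [mem_half_true] at hx
    rw [abs_of_nonpos hx, sgm] at h1
    rw [sgm] at hx
    rw [min_eq_left (by linarith)] at h2
    simp only [if_true, mul_add, zero_add, e, h1, h2]
    exact ⟨trivial, by ring⟩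

theorem IsModel.injOn_half (hκ : κ = 1 ∨ κ = 2) (hf : IsModel κ f) {x y : Delta n} {a : Bool}
    (hx : x ∈ half n a) (hy : y ∈ half n a) (hxy : f x = f y) : x = y := by
  have hκ0 := (kappa_pos hκ).ne'
  obtain ⟨x1, x2⟩ := hf.recover hx
  obtain ⟨y1, y2⟩ := hf.recover hy
  rw [hxy] at x1 x2
  refine (eq_of_proportional (mass_pos hκ y).ne' (b := mass κ x) ?_ ?_).2
  · apply mul_left_cancel₀ hκ0
    rw [mul_left_comm, x1, mul_left_comm κ, y1]; ring
  · intro i hi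
    rcases i with _ | i
    · apply mul_left_cancel₀ hκ0
      rw [mul_left_comm, x2, mul_left_comm κ, y2]; ring
    · rw [← hf.shift x i hi, ← hf.shift y i hi, hxy]; ring

/-- Each of the two halves is mapped onto `Δ`. -/
theorem IsModel.exists_preimage (hκ : κ = 1 ∨ κ = 2) (hf : IsModel κ f) (a : Bool) (y : Delta n) :
    ∃ x ∈ half n a, f x = y := by
  have hn : 0 < n := Nat.pos_of_ne_zero (NeZero.ne n)
  have hκ0 := kappa_pos hκ
  set m : ℝ := qu y (n - 1) / κ with hm
  have hm0 : 0 ≤ m := div_nonneg (qu_nonneg _ _) hκ0.le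
  have hκm : κ * m = qu y (n - 1) := by rw [hm]; field_simp
  have hy0 := hd_nonneg y
  -- the sum of the unnormalized coordinates of the preimage
  set S : ℝ := hd y + 2 * m + ∑ i ∈ Finset.range (n - 1), qu y i with hS
  have hsum := hd_add_sum y
  rw [sum_eq_pred_add] at hsum
  have hSpos : 0 < S := by rcases hκ with rfl | rfl <;> linarith
  let b : ℕ → ℝ := fun i => (match i with
    | 0 => if a then hd y + m else m
    | i + 1 => qu y i) / S
  have hb0 : b 0 = (if a then hd y + m else m) / S := rfl
  have hbs : ∀ i, b (i + 1) = qu y i / S := fun i => rfl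
  obtain ⟨x, hxh, hxq⟩ := exists_point (n := n) (a := (if a then m else hd y + m) / S) (b := b)
    (div_nonneg (by split_ifs <;> linarith) hSpos.le)
    (fun i _ => by
      rcases i with _ | i
      · rw [hb0]; exact div_nonneg (by split_ifs <;> linarith) hSpos.le
      · rw [hbs]; exact div_nonneg (qu_nonneg _ _) hSpos.le)
    (by
      rw [sum_eq_zero_add_pred, hb0]
      simp only [hbs]
      rw [← Finset.sum_div, ← add_div, ← add_div, div_eq_one_iff_eq hSpos.ne', hS]
      split_ifs <;> ring)
  have hx0 := hxq 0 hn
  rw [hb0] at hx0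
  have hsg : sgm x = (if a then -hd y else hd y) / S := by
    rw [sgm, hxh, hx0, ← sub_div]
    split_ifs <;> ring
  refine ⟨x, ?_, ?_⟩
  · cases a
    · rw [mem_half_false, hsg]
      exact div_nonneg (by simpa using hy0) hSpos.le
    · rw [mem_half_true, hsg]
      exact div_nonpos_of_nonpos_of_nonneg (by simpa using hy0) hSpos.le
  · refine (eq_of_proportional (mass_pos hκ x).ne' (b := 1 / S) ?_ ?_).2
    · rw [hf.head, hsg, abs_div, abs_of_pos hSpos]
      split_ifs
      · rw [abs_neg, abs_of_nonneg hy0]; ring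
      · rw [abs_of_nonneg hy0]; ring
    · intro i hi
      rcases Nat.lt_or_ge (i + 1) n with h | h
      · rw [hf.shift x i h, hxq _ h, hbs]; ring
      · obtain rfl : i = n - 1 := by omega
        rw [hf.push, hxh, hx0]
        have : min ((if a then m else hd y + m) / S) ((if a then hd y + m else m) / S) = m / S := by
          have : m / S ≤ (hd y + m) / S := div_le_div_of_nonneg_right (by linarith) hSpos.le
          split_ifs
          exacts [min_eq_left this, min_eq_right this]
        rw [this, ← hκm]; ring

theorem IsModel.hd_eq_zero_iff (hκ : κ = 1 ∨ κ = 2) (hf : IsModel κ f) (x : Delta n) :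
    hd (f x) = 0 ↔ sgm x = 0 := by
  rw [← abs_eq_zero (a := sgm x), ← hf.head x, mul_eq_zero, or_iff_right (mass_pos hκ x).ne']

/-- The points `x` and `y` lie in the interior of the same face of `Δ`. -/
def SameFace (x y : Delta n) : Prop :=
  (hd x = 0 ↔ hd y = 0) ∧ ∀ i < n, qu x i = 0 ↔ qu y i = 0

/-- The inverse branches of all models act in the same way on the faces of `Δ`. -/
theorem SameFace.of_image (hκ : κ = 1 ∨ κ = 2) (hκ' : κ' = 1 ∨ κ' = 2) (hf : IsModel κ f)
    (hg : IsModel κ' g) {x y : Delta n} {a : Bool} (hx : x ∈ half n a) (hy : y ∈ half n a)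
    (h : SameFace (f x) (g y)) : SameFace x y := by
  have hn : 0 < n := Nat.pos_of_ne_zero (NeZero.ne n)
  obtain ⟨x1, x2⟩ := hf.recover hx
  obtain ⟨y1, y2⟩ := hg.recover hy
  have aux : ∀ {κ m u v r : ℝ} (c : Prop) [Decidable c], 0 < κ → 0 < m → 0 ≤ u → 0 ≤ v →
      κ * r = m * ((if c then κ * u else 0) + v) → (r = 0 ↔ (c → u = 0) ∧ v = 0) := by
    intro κ m u v r c _ hκ hm hu hv e
    rw [← mul_right_inj' hκ.ne', mul_zero, e, mul_eq_zero, or_iff_right hm.ne']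
    split_ifs with hc
    · rw [add_eq_zero_iff_of_nonneg (mul_nonneg hκ.le hu) hv, mul_eq_zero, or_iff_right hκ.ne']
      simp [hc]
    · simp [hc]
  have swap : ∀ (c : Bool) (u : ℝ), (if c then 0 else u) = if c = false then u else 0 := by
    intro c u; cases c <;> simp
  rw [swap] at x1 y1
  refine ⟨?_, fun i hi => ?_⟩
  · rw [aux _ (kappa_pos hκ) (mass_pos hκ x) (hd_nonneg _) (qu_nonneg _ _) x1,
      aux _ (kappa_pos hκ') (mass_pos hκ' y) (hd_nonneg _) (qu_nonneg _ _) y1, h.1,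
      h.2 _ (by omega)]
  · rcases i with _ | i
    · rw [aux _ (kappa_pos hκ) (mass_pos hκ x) (hd_nonneg _) (qu_nonneg _ _) x2,
        aux _ (kappa_pos hκ') (mass_pos hκ' y) (hd_nonneg _) (qu_nonneg _ _) y2, h.1,
        h.2 _ (by omega)]
    · rw [← hf.shift x i hi, ← hg.shift y i hi, mul_eq_zero, mul_eq_zero,
        or_iff_right (mass_pos hκ x).ne', or_iff_right (mass_pos hκ' y).ne']
      exact h.2 i (by omega)

theorem mem_half_cases (x : Delta n) : ∃ a, x ∈ half n a := by
  rcases le_total 0 (sgm x) with h | h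
  exacts [⟨false, mem_half_false.2 h⟩, ⟨true, mem_half_true.2 h⟩]

theorem sgm_mul_nonneg {x y : Delta n} {a : Bool} (hx : x ∈ half n a) (hy : y ∈ half n a) :
    0 ≤ sgm x * sgm y := by
  cases a
  · exact mul_nonneg (mem_half_false.1 hx) (mem_half_false.1 hy)
  · exact mul_nonneg_of_nonpos_of_nonpos (mem_half_true.1 hx) (mem_half_true.1 hy)

end Branches

/-! ### Continuity -/

section Continuity

variable {n : ℕ} [NeZero n] {κ : ℝ} {f : Delta n → Delta n}

omit [NeZero n] in
theorem continuous_coord (i : Fin n) : Continuous fun x : Delta n => x.1 i :=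
  (continuous_apply i).comp continuous_subtype_val

theorem continuous_hd : Continuous (hd : Delta n → ℝ) := continuous_const.sub (continuous_coord 0)

omit [NeZero n] in
theorem continuous_qu (i : ℕ) : Continuous fun x : Delta n => qu x i := by
  have : ∀ j : ℕ, Continuous fun x : Delta n => ext x j := by
    intro j
    unfold ext
    split_ifs with h
    exacts [continuous_coord _, continuous_const]
  exact (this _).sub (this _)

theorem continuous_sgm : Continuous (sgm : Delta n → ℝ) := continuous_hd.sub (continuous_qu 0)

omit [NeZero n] in
theorem continuous_of_qu {X : Type*} [TopologicalSpace X] {φ : X → Delta n}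
    (h : ∀ i < n, Continuous fun x => qu (φ x) i) : Continuous φ := by
  refine continuous_induced_rng.2 (continuous_pi fun i => ?_)
  have : (fun x => (Subtype.val ∘ φ) x i) =
      fun x => ∑ k ∈ Finset.range (n - i), qu (φ x) k := by
    funext x
    exact coord_eq_sum _ _
  rw [this]
  refine continuous_finsetSum _ fun k hk => h k ?_
  have := Finset.mem_range.1 hk
  omega

theorem IsModel.continuous (hκ : κ = 1 ∨ κ = 2) (hf : IsModel κ f) : Continuous f := by
  have hmin : Continuous fun x : Delta n => min (hd x) (qu x 0) :=
    continuous_hd.min (continuous_qu 0)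
  have hmass : Continuous (mass κ : Delta n → ℝ) :=
    continuous_const.sub (continuous_const.mul hmin)
  refine continuous_of_qu fun i hi => ?_
  have key : ∀ {φ : Delta n → ℝ}, Continuous φ → (∀ x, mass κ x * qu (f x) i = φ x) →
      Continuous fun x => qu (f x) i := by
    intro φ hφ h
    have : (fun x => qu (f x) i) = fun x => φ x / mass κ x := by
      funext x
      rw [← h, mul_div_cancel_left₀ _ (mass_pos hκ x).ne']
    rw [this]
    exact hφ.div hmass fun x => (mass_pos hκ x).ne'
  rcases Nat.lt_or_ge (i + 1) n with h | h
  · exact key (continuous_qu (i + 1)) fun x => hf.shift x i h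
  · obtain rfl : i = n - 1 := by omega
    exact key (continuous_const.mul hmin) hf.push

instance instCompactDelta : CompactSpace (Delta n) :=
  isCompact_iff_compactSpace.1 ((Set.finite_range (vertex n)).isCompact_convexHull ℝ)

end Continuity

/-! ### The conjugating homeomorphism -/

section Conjugacy

variable {n : ℕ} [NeZero n] {κ κ' : ℝ} {f g : Delta n → Delta n}

/-- At all times, the orbits of `x` under `f` and of `y` under `g` are in a common half of `Δ`. -/
def Shadows (f g : Delta n → Delta n) (x y : Delta n) : Prop :=
  ∀ t, 0 ≤ sgm (f^[t] x) * sgm (g^[t] y)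

theorem Shadows.symm {x y : Delta n} (h : Shadows f g x y) : Shadows g f y x := fun t => by
  rw [mul_comm]; exact h t

theorem Shadows.map {x y : Delta n} (h : Shadows f g x y) : Shadows f g (f x) (g y) := fun t => by
  rw [← Function.iterate_succ_apply, ← Function.iterate_succ_apply]; exact h (t + 1)

/-- For the first `t` steps, the shadow is found by pulling the point `fᵗ(x)` itself back along the
inverse branches of `g`. -/
theorem exists_shadow_finite (hκ : κ = 1 ∨ κ = 2) (hκ' : κ' = 1 ∨ κ' = 2) (hf : IsModel κ f)
    (hg : IsModel κ' g) (t : ℕ) (x : Delta n) : ∃ y, SameFace x y ∧ ∀ s < t,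
      0 ≤ sgm (f^[s] x) * sgm (g^[s] y) ∧ (sgm (f^[s] x) = 0 → sgm (g^[s] y) = 0) := by
  induction t generalizing x with
  | zero => exact ⟨x, ⟨Iff.rfl, fun _ _ => Iff.rfl⟩, fun s hs => absurd hs (Nat.not_lt_zero s)⟩
  | succ t ih =>
    obtain ⟨z, hz, hzs⟩ := ih (f x)
    obtain ⟨a, ha⟩ := mem_half_cases x
    obtain ⟨y, hy, rfl⟩ := hg.exists_preimage hκ' a z
    refine ⟨y, SameFace.of_image hκ hκ' hf hg ha hy hz, fun s hs => ?_⟩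
    rcases s with _ | s
    · refine ⟨sgm_mul_nonneg ha hy, fun h => ?_⟩
      rw [Function.iterate_zero_apply, ← hf.hd_eq_zero_iff hκ, hz.1] at h
      exact (hg.hd_eq_zero_iff hκ' y).1 h
    · rw [Function.iterate_succ_apply, Function.iterate_succ_apply]
      exact hzs s (by omega)

theorem exists_shadow (hκ : κ = 1 ∨ κ = 2) (hκ' : κ' = 1 ∨ κ' = 2) (hf : IsModel κ f)
    (hg : IsModel κ' g) (x : Delta n) :
    ∃ y, Shadows f g x y ∧ ∀ s, sgm (f^[s] x) = 0 → sgm (g^[s] y) = 0 := by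
  have hcont : ∀ s, Continuous fun y => sgm (g^[s] y) := fun s =>
    continuous_sgm.comp ((hg.continuous hκ').iterate s)
  let K : ℕ → Set (Delta n) := fun t => {y | ∀ s < t,
      0 ≤ sgm (f^[s] x) * sgm (g^[s] y) ∧ (sgm (f^[s] x) = 0 → sgm (g^[s] y) = 0)}
  have hclosed : ∀ t, IsClosed (K t) := by
    intro t
    simp only [K, Set.ofPred_forall, Set.ofPred_and]
    refine isClosed_iInter fun s => isClosed_iInter fun _ => IsClosed.inter ?_ ?_
    · exact isClosed_le continuous_const (continuous_const.mul (hcont s))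
    · exact isClosed_iInter fun _ => isClosed_eq (hcont s) continuous_const
  obtain ⟨y, hy⟩ := IsCompact.nonempty_iInter_of_sequence_nonempty_isCompact_isClosed K
    (fun t y hy s hs => hy s (by omega))
    (fun t => by
      obtain ⟨y, -, hy⟩ := exists_shadow_finite hκ hκ' hf hg t x
      exact ⟨y, hy⟩)
    (hclosed 0).isCompact hclosed
  have hy : ∀ s, 0 ≤ sgm (f^[s] x) * sgm (g^[s] y) ∧ (sgm (f^[s] x) = 0 → sgm (g^[s] y) = 0) :=
    fun s => Set.mem_iInter.1 hy (s + 1) s (Nat.lt_succ_self s)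
  exact ⟨y, fun s => (hy s).1, fun s => (hy s).2⟩

/-- Where the orbit of `x` hits the wall, the orbit of its shadow does so too. Hence two shadows of
`x` are never strictly separated by the wall. -/
theorem Shadows.unique (hκ : κ = 1 ∨ κ = 2) (hκ' : κ' = 1 ∨ κ' = 2) (hf : IsModel κ f)
    (hg : IsModel κ' g) {x y y' : Delta n} (h : Shadows f g x y) (h' : Shadows f g x y') :
    y = y' := by
  obtain ⟨z, hz, hz0⟩ := exists_shadow hκ hκ' hf hg x
  have key : ∀ y, Shadows f g x y → z = y := by
    intro y hy
    refine eq_of_itinerary hκ' hg fun t => ?_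
    by_cases h0 : sgm (f^[t] x) = 0
    · rw [hz0 t h0, zero_mul]
    · have h2 := mul_nonneg (hz t) (hy t)
      have h3 : 0 < sgm (f^[t] x) * sgm (f^[t] x) := mul_self_pos.2 h0
      exact (mul_nonneg_iff_of_pos_left h3).1 (by linarith)
  rw [← key y h, ← key y' h']

theorem isClosed_shadows (hκ : κ = 1 ∨ κ = 2) (hκ' : κ' = 1 ∨ κ' = 2) (hf : IsModel κ f)
    (hg : IsModel κ' g) : IsClosed {p : Delta n × Delta n | Shadows f g p.1 p.2} := by
  simp only [Shadows, Set.ofPred_forall]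
  refine isClosed_iInter fun t => isClosed_le continuous_const ?_
  exact (continuous_sgm.comp (((hf.continuous hκ).iterate t).comp continuous_fst)).mul
    (continuous_sgm.comp (((hg.continuous hκ').iterate t).comp continuous_snd))

theorem exists_shadowing_homeo (hκ : κ = 1 ∨ κ = 2) (hκ' : κ' = 1 ∨ κ' = 2) (hf : IsModel κ f)
    (hg : IsModel κ' g) : ∃ Φ : Delta n ≃ₜ Delta n, ∀ x, Shadows f g x (Φ x) := by
  have e1 := fun x => (exists_shadow hκ hκ' hf hg x).imp fun _ h => h.1
  have e2 := fun x => (exists_shadow hκ' hκ hg hf x).imp fun _ h => h.1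
  choose φ hφ using e1
  choose ψ hψ using e2
  let Ψ : Delta n ≃ Delta n :=
    ⟨φ, ψ, fun x => Shadows.unique hκ' hκ hg hf (hψ (φ x)) (hφ x).symm,
      fun x => Shadows.unique hκ hκ' hf hg (hφ (ψ x)) (hψ x).symm⟩
  have hcont : Continuous Ψ := by
    refine continuous_iff_isClosed.2 fun C hC => ?_
    have : Ψ ⁻¹' C = Prod.fst ''
        ({p : Delta n × Delta n | Shadows f g p.1 p.2} ∩ Prod.snd ⁻¹' C) := by
      ext x
      constructor
      · intro hx
        exact ⟨(x, φ x), ⟨hφ x, hx⟩, rfl⟩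
      · rintro ⟨⟨x, y⟩, ⟨hs, hy⟩, rfl⟩
        have hs : Shadows f g x y := hs
        have hy : y ∈ C := hy
        rwa [Shadows.unique hκ hκ' hf hg hs (hφ x)] at hy
    rw [this]
    exact isClosedMap_fst_of_compactSpace _
      ((isClosed_shadows hκ hκ' hf hg).inter (hC.preimage continuous_snd))
  exact ⟨hcont.homeoOfEquivCompactToT2, hφ⟩

theorem conj_of_shadowing (hκ : κ = 1 ∨ κ = 2) (hκ' : κ' = 1 ∨ κ' = 2) (hf : IsModel κ f)
    (hg : IsModel κ' g) {Φ : Delta n ≃ₜ Delta n} (h : ∀ x, Shadows f g x (Φ x)) (x : Delta n) :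
    Φ (f x) = g (Φ x) :=
  Shadows.unique hκ hκ' hf hg (h (f x)) (h x).map

omit [NeZero n] in
theorem convex_Delta_comb {x y : Delta n} {a b : ℝ} (ha : 0 ≤ a) (hb : 0 ≤ b) (hab : a + b = 1) :
    a • x.1 + b • y.1 ∈ Delta n := convex_convexHull ℝ _ x.2 y.2 ha hb hab

theorem isPreconnected_sgm_side (c : ℝ) : IsPreconnected {x : Delta n | 0 < c * sgm x} := by
  rw [← Topology.IsInducing.subtypeVal.isPreconnected_image]
  refine Convex.isPreconnected ?_
  rintro _ ⟨x, hx, rfl⟩ _ ⟨y, hy, rfl⟩ a b ha hb hab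
  refine ⟨⟨_, convex_Delta_comb ha hb hab⟩, ?_, rfl⟩
  simp only [Set.mem_ofPred_eq, sgm, hd, qu_zero, Pi.add_apply, Pi.smul_apply, smul_eq_mul] at *
  have e : c * (1 - (a * x.1 0 + b * y.1 0) - (a * x.1 (lastIdx n) + b * y.1 (lastIdx n))) =
      a * (c * (1 - x.1 0 - x.1 (lastIdx n))) + b * (c * (1 - y.1 0 - y.1 (lastIdx n))) := by
    linear_combination (-c) * hab
  rw [e]
  rcases ha.eq_or_lt with rfl | ha
  · obtain rfl : b = 1 := by linarith
    simpa using hy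
  · have := mul_pos ha hx
    have := mul_nonneg hb hy.le
    linarith

/-- The wall consists of the points that have the only preimage of their image. -/
theorem IsModel.sgm_eq_zero_iff (hκ : κ = 1 ∨ κ = 2) (hf : IsModel κ f) (x : Delta n) :
    sgm x = 0 ↔ ∀ x', f x' = f x → x' = x := by
  constructor
  · intro h x' hx'
    have h1 : sgm x' = 0 := by
      rw [← hf.hd_eq_zero_iff hκ, hx', hf.hd_eq_zero_iff hκ, h]
    exact hf.injOn_half hκ (mem_half_false.2 h1.ge) (mem_half_false.2 h.ge) hx'
  · intro h
    obtain ⟨y, hy, hfy⟩ := hf.exists_preimage hκ false (f x)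
    obtain ⟨z, hz, hfz⟩ := hf.exists_preimage hκ true (f x)
    rw [h y hfy, mem_half_false] at hy
    rw [h z hfz, mem_half_true] at hz
    exact le_antisymm hz hy

theorem IsModel.hd_eq_zero_iff_exists (hκ : κ = 1 ∨ κ = 2) (hf : IsModel κ f) (x : Delta n) :
    hd x = 0 ↔ ∃ x', sgm x' = 0 ∧ f x' = x := by
  constructor
  · intro h
    obtain ⟨y, -, rfl⟩ := hf.exists_preimage hκ false x
    exact ⟨y, (hf.hd_eq_zero_iff hκ y).1 h, rfl⟩
  · rintro ⟨y, hy, rfl⟩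
    exact (hf.hd_eq_zero_iff hκ y).2 hy

/-- A homeomorphism that conjugates two models preserves the wall, hence it permutes the two
components of its complement. It fixes them since it preserves the image of the wall, which is a
facet of `Δ` contained in `Δ₁`. -/
theorem sgm_mul_nonneg_of_conj (hκ : κ = 1 ∨ κ = 2) (hκ' : κ' = 1 ∨ κ' = 2) (hf : IsModel κ f)
    (hg : IsModel κ' g) {Φ : Delta n ≃ₜ Delta n} (h : ∀ x, Φ (f x) = g (Φ x)) (x : Delta n) :
    0 ≤ sgm x * sgm (Φ x) := by
  have wall : ∀ x, sgm (Φ x) = 0 ↔ sgm x = 0 := by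
    intro x
    rw [hg.sgm_eq_zero_iff hκ' (Φ x), hf.sgm_eq_zero_iff hκ x]
    constructor
    · intro hx x' hx'
      refine Φ.injective (hx _ ?_)
      rw [← h, ← h, hx']
    · intro hx y hy
      obtain ⟨x', rfl⟩ := Φ.surjective y
      rw [← h, ← h, Φ.injective.eq_iff] at hy
      rw [hx x' hy]
  have facet : ∀ x, hd x = 0 → hd (Φ x) = 0 := by
    intro x hx
    obtain ⟨x', h1, rfl⟩ := (hf.hd_eq_zero_iff_exists hκ x).1 hx
    exact (hg.hd_eq_zero_iff_exists hκ' _).2 ⟨Φ x', (wall x').2 h1, (h x').symm⟩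
  -- two points on the same strict side of the wall have images on the same strict side
  have side : ∀ c : ℝ, ∀ x y, 0 < c * sgm x → 0 < c * sgm y → 0 < sgm (Φ x) * sgm (Φ y) := by
    intro c x y hx hy
    have hne : ∀ z, 0 < c * sgm z → sgm (Φ z) ≠ 0 := fun z hz h0 => by
      rw [(wall z).1 h0, mul_zero] at hz
      exact lt_irrefl _ hz
    have hcon := (isPreconnected_sgm_side (n := n) c).image (fun z => sgm (Φ z))
      (continuous_sgm.comp Φ.continuous).continuousOn
    have hord := hcon.ordConnected
    have mx : sgm (Φ x) ∈ (fun z => sgm (Φ z)) '' {x : Delta n | 0 < c * sgm x} := ⟨x, hx, rfl⟩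
    have my : sgm (Φ y) ∈ (fun z => sgm (Φ z)) '' {x : Delta n | 0 < c * sgm x} := ⟨y, hy, rfl⟩
    have no : (0 : ℝ) ∉ (fun z => sgm (Φ z)) '' {x : Delta n | 0 < c * sgm x} := by
      rintro ⟨z, hz, h0⟩
      exact hne z hz h0
    rcases lt_or_gt_of_ne (hne x hx) with h1 | h1 <;> rcases lt_or_gt_of_ne (hne y hy) with h2 | h2
    · exact mul_pos_of_neg_of_neg h1 h2
    · exact absurd (hord.out mx my ⟨h1.le, h2.le⟩) no
    · exact absurd (hord.out my mx ⟨h2.le, h1.le⟩) no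
    · exact mul_pos h1 h2
  -- the vertex of `Δ₁` opposite to the wall lies on the facet
  obtain ⟨e, he, heq⟩ := exists_point (n := n) (a := 0) (b := fun i => if i = 0 then 1 else 0)
    le_rfl
    (fun i _ => by split_ifs <;> norm_num)
    (by simp [Nat.pos_of_ne_zero (NeZero.ne n)])
  have hse : sgm e = -1 := by
    rw [sgm, he, heq 0 (Nat.pos_of_ne_zero (NeZero.ne n))]; norm_num
  have hΦe : sgm (Φ e) < 0 := by
    refine lt_of_le_of_ne ?_ fun h0 => ?_
    · rw [sgm, facet e he]
      linarith [qu_nonneg (Φ e) 0]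
    · rw [wall, hse] at h0
      norm_num at h0
  have neg : ∀ x, sgm x < 0 → sgm (Φ x) < 0 := fun x hx => by
    have := side (-1) e x (by rw [hse]; norm_num) (by linarith)
    exact neg_of_mul_pos_right this hΦe.le
  have pos : ∀ x, 0 < sgm x → 0 < sgm (Φ x) := by
    intro x hx
    -- `v₁`, which is strictly on this side of the wall, is the image of some point
    obtain ⟨v, hv, hvq⟩ := exists_point (n := n) (a := 1) (b := fun _ => 0) zero_le_one
      (fun i _ => le_rfl) (by simp)
    have hsv : sgm v = 1 := by
      rw [sgm, hv, hvq 0 (Nat.pos_of_ne_zero (NeZero.ne n))]; norm_num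
    obtain ⟨u, rfl⟩ := Φ.surjective v
    have hu : 0 < sgm u := by
      rcases lt_trichotomy (sgm u) 0 with h0 | h0 | h0
      · linarith [neg u h0]
      · linarith [(wall u).2 h0]
      · exact h0
    have := side 1 u x (by linarith) (by linarith)
    rw [hsv, one_mul] at this
    exact this
  rcases lt_trichotomy (sgm x) 0 with h0 | h0 | h0
  · exact (mul_pos_of_neg_of_neg h0 (neg x h0)).le
  · rw [h0, zero_mul]
  · exact (mul_pos h0 (pos x h0)).le

theorem shadows_of_conj (hκ : κ = 1 ∨ κ = 2) (hκ' : κ' = 1 ∨ κ' = 2) (hf : IsModel κ f)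
    (hg : IsModel κ' g) {Φ : Delta n ≃ₜ Delta n} (h : ∀ x, Φ (f x) = g (Φ x)) (x : Delta n) :
    Shadows f g x (Φ x) := by
  intro t
  rw [← Function.Semiconj.iterate_right (f := Φ) (fun x => h x) t x]
  exact sgm_mul_nonneg_of_conj hκ hκ' hf hg h _

theorem isMinkowski_iff {Φ : Delta n ≃ₜ Delta n} :
    IsMinkowski Φ ↔ ∀ x, Φ (M n x) = T n (Φ x) := by
  constructor
  · intro h x
    have : T n = Φ ∘ M n ∘ Φ.symm := h
    rw [this]; simp
  · intro h
    funext x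
    have := h (Φ.symm x)
    simpa using this.symm

theorem existsUnique_isMinkowski : ∃! Φ : Delta n ≃ₜ Delta n, IsMinkowski Φ := by
  obtain ⟨Φ, hΦ⟩ := exists_shadowing_homeo (n := n) (Or.inl rfl) (Or.inr rfl) isModel_M isModel_T
  refine ⟨Φ, isMinkowski_iff.2
    (conj_of_shadowing (Or.inl rfl) (Or.inr rfl) isModel_M isModel_T hΦ), fun Ψ hΨ => ?_⟩
  ext1 x
  exact Shadows.unique (Or.inl rfl) (Or.inr rfl) isModel_M isModel_T
    (shadows_of_conj (Or.inl rfl) (Or.inr rfl) isModel_M isModel_T (isMinkowski_iff.1 hΨ) x) (hΦ x)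

end Conjugacy

/-! ### Orbits that reach `v₁` -/

section GrandOrbit

theorem EPO_eq_singleton_iff {X : Type*} {f : X → X} {v : X} (hv : f v = v) (p : X) :
    EPO f p = {v} ↔ ∃ t, f^[t] p = v := by
  constructor
  · intro h
    obtain ⟨t, -, -, ht, -⟩ : v ∈ EPO f p := by rw [h]; rfl
    exact ⟨t, ht.symm⟩
  · rintro ⟨t, ht⟩
    have hlate : ∀ s, f^[s + t] p = v := fun s => by
      rw [Function.iterate_add_apply, ht, Function.iterate_fixed hv]
    ext q
    constructor
    · rintro ⟨a, b, hab, ha, hb⟩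
      obtain ⟨d, rfl⟩ := Nat.exists_eq_add_of_lt hab
      have hper : ∀ m, f^[(d + 1) * m + a] p = q := by
        intro m
        induction m with
        | zero => simpa using ha.symm
        | succ m ih =>
          rw [show (d + 1) * (m + 1) + a = (d + 1) + ((d + 1) * m + a) by ring,
            Function.iterate_add_apply, ih, ha, ← Function.iterate_add_apply,
            show d + 1 + a = a + d + 1 by ring, ← hb, ha]
      rw [Set.mem_singleton_iff, ← hper t,
        show (d + 1) * t + a = (d * t + a) + t by ring]
      exact hlate _
    · rintro rfl
      exact ⟨t, t + 1, Nat.lt_succ_self t, ht.symm, by rw [add_comm]; exact (hlate 1).symm⟩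

theorem GO_eq {X : Type*} {f : X → X} {v : X} (hv : f v = v) : GO f v = {p | ∃ t, f^[t] p = v} := by
  ext q
  constructor
  · rintro ⟨t, s, h⟩
    exact ⟨s, by rw [← h, Function.iterate_fixed hv]⟩
  · rintro ⟨s, h⟩
    exact ⟨0, s, h.symm⟩

variable {n : ℕ} [NeZero n] {κ : ℝ} {f : Delta n → Delta n}

omit [NeZero n] in
theorem qu_v₁ (i : ℕ) : qu (v₁ n) i = 0 := by
  have : ∀ j, ext (v₁ n) j = 0 := fun j => by
    unfold ext
    split_ifs <;> simp [v₁, vertex]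
  simp [qu, this]

theorem hd_v₁ : hd (v₁ n) = 1 := by simp [hd, v₁, vertex]

omit [NeZero n] in
theorem eq_v₁_iff {x : Delta n} : x = v₁ n ↔ ∀ i < n, qu x i = 0 :=
  ⟨fun h i _ => by rw [h, qu_v₁], fun h => ext_of_qu fun i hi => by rw [h i hi, qu_v₁]⟩

theorem IsModel.map_v₁ (hκ : κ = 1 ∨ κ = 2) (hf : IsModel κ f) : f (v₁ n) = v₁ n := by
  refine eq_v₁_iff.2 fun i hi => ?_
  have key : mass κ (v₁ n) * qu (f (v₁ n)) i = 0 := by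
    rcases Nat.lt_or_ge (i + 1) n with h | h
    · rw [hf.shift _ _ h, qu_v₁]
    · obtain rfl : i = n - 1 := by omega
      rw [hf.push, qu_v₁, hd_v₁]; simp
  exact (mul_eq_zero.1 key).resolve_left (mass_pos hκ _).ne'

/-- After a full turn of the queue, every element of it has been pushed. -/
theorem IsModel.qu_iterate (hf : IsModel κ f) (x : Delta n) {i : ℕ} (hi : i < n) :
    scale κ f x n * qu (f^[n] x) i =
      scale κ f x i * (κ * min (hd (f^[i] x)) (qu (f^[i] x) 0)) := by
  rw [← runQueue_add hf x hi, show n + i = i + 1 + (n - 1) by omega, runQueue_add hf x (by omega),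
    scale_succ, mul_assoc, Function.iterate_succ_apply', hf.push]

/-! ### Denominators -/

/-- The barycentric coordinates of `x`, multiplied by `r`, lie in the group `A`. -/
def InLattice (A : AddSubgroup ℝ) (r : ℝ) (x : Delta n) : Prop := r ∈ A ∧ ∀ i < n, r * qu x i ∈ A

variable {A : AddSubgroup ℝ} {r : ℝ} {x : Delta n}

theorem InLattice.hd_mem (h : InLattice A r x) : r * hd x ∈ A := by
  have : r * hd x = r - ∑ i ∈ Finset.range n, r * qu x i := by
    rw [← Finset.mul_sum, ← mul_one_sub, ← hd_add_sum x]; ring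
  rw [this]
  exact A.sub_mem h.1 (A.sum_mem fun i hi => h.2 i (Finset.mem_range.1 hi))

theorem InLattice.min_mem (h : InLattice A r x) : r * min (hd x) (qu x 0) ∈ A := by
  rcases min_choice (hd x) (qu x 0) with e | e <;> rw [e]
  exacts [h.hd_mem, h.2 0 (Nat.pos_of_ne_zero (NeZero.ne n))]

theorem InLattice.map (hκ : κ = 1 ∨ κ = 2) (hf : IsModel κ f) (h : InLattice A r x) :
    InLattice A (r * mass κ x) (f x) := by
  have hm := h.min_mem
  refine ⟨?_, fun i hi => ?_⟩
  · rcases hκ with rfl | rfl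
    · have : r * mass 1 x = r - r * min (hd x) (qu x 0) := by rw [mass]; ring
      rw [this]
      exact A.sub_mem h.1 hm
    · simpa [mass] using h.1
  · rw [mul_assoc]
    rcases Nat.lt_or_ge (i + 1) n with h' | h'
    · rw [hf.shift _ _ h']
      exact h.2 _ h'
    · obtain rfl : i = n - 1 := by omega
      rw [hf.push]
      rcases hκ with rfl | rfl
      · simpa using hm
      · rw [two_mul, mul_add]
        exact A.add_mem hm hm

theorem InLattice.iterate (hκ : κ = 1 ∨ κ = 2) (hf : IsModel κ f) (h : InLattice A r x) (t : ℕ) :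
    InLattice A (r * scale κ f x t) (f^[t] x) := by
  induction t with
  | zero => simpa [scale] using h
  | succ t ih =>
    rw [scale_succ, ← mul_assoc, Function.iterate_succ_apply']
    exact ih.map hκ hf

/-- The additive group of the integers, as real numbers. -/
def integers : AddSubgroup ℝ := (Int.castAddHom ℝ).range

theorem mem_integers {r : ℝ} : r ∈ integers ↔ ∃ k : ℤ, (k : ℝ) = r := Iff.rfl

theorem one_le_of_mem_integers {r : ℝ} (h : r ∈ integers) (hr : 0 < r) : 1 ≤ r := by
  obtain ⟨k, rfl⟩ := mem_integers.1 h
  have : (0 : ℤ) < k := by exact_mod_cast hr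
  exact_mod_cast this

/-- The Euclidean algorithm: as long as the orbit has not reached `v₁`, the common denominator of the
coordinates decreases within every `n` steps. -/
theorem exists_iterate_eq_v₁_of_one (hf : IsModel 1 f) (m : ℕ) {r : ℝ} {x : Delta n} (hr : 0 < r)
    (hm : r ≤ m) (hx : InLattice integers r x) : ∃ t, f^[t] x = v₁ n := by
  have h1 : (1 : ℝ) = 1 ∨ (1 : ℝ) = 2 := Or.inl rfl
  induction m generalizing r x with
  | zero => exact absurd hm (by simpa using hr)
  | succ m ih =>
    by_cases h : ∃ s < n, 0 < min (hd (f^[s] x)) (qu (f^[s] x) 0)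
    · obtain ⟨s, -, hs⟩ := h
      have hle : scale 1 f x s ≤ 1 := by
        refine Finset.prod_le_one (fun _ _ => (mass_pos h1 _).le) fun i _ => ?_
        have : 0 ≤ min (hd (f^[i] x)) (qu (f^[i] x) 0) := le_min (hd_nonneg _) (qu_nonneg _ _)
        rw [mass]; linarith
      have hl := hx.iterate h1 hf s
      have hrs : 0 < r * scale 1 f x s := mul_pos hr (scale_pos h1 x s)
      have hdec := one_le_of_mem_integers hl.min_mem (mul_pos hrs hs)
      have e : r * scale 1 f x s * mass 1 (f^[s] x) = r * scale 1 f x s -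
          r * scale 1 f x s * min (hd (f^[s] x)) (qu (f^[s] x) 0) := by rw [mass]; ring
      have hrle : r * scale 1 f x s ≤ r := mul_le_of_le_one_right hr.le hle
      obtain ⟨t, ht⟩ := ih (x := f (f^[s] x)) (mul_pos hrs (mass_pos h1 (f^[s] x)))
        (by rw [e]; push_cast at hm; linarith) (hl.map h1 hf)
      exact ⟨t + (s + 1), by rw [Function.iterate_add_apply, Function.iterate_succ_apply', ht]⟩
    · push Not at h
      refine ⟨n, eq_v₁_iff.2 fun i hi => ?_⟩
      have hmin : min (hd (f^[i] x)) (qu (f^[i] x) 0) = 0 :=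
        le_antisymm (h i hi) (le_min (hd_nonneg _) (qu_nonneg _ _))
      have := hf.qu_iterate x hi
      rw [hmin, mul_zero, mul_zero] at this
      exact (mul_eq_zero.1 this).resolve_left (scale_pos h1 x n).ne'

/-- For the tent map, the exponent of the common denominator decreases every `n` steps. -/
theorem exists_iterate_eq_v₁_of_two (hf : IsModel 2 f) (k : ℕ) {x : Delta n}
    (hx : InLattice integers (2 ^ k) x) : ∃ t, f^[t] x = v₁ n := by
  have h2 : (2 : ℝ) = 1 ∨ (2 : ℝ) = 2 := Or.inr rfl
  have hq : ∀ x : Delta n, ∀ i < n,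
      qu (f^[n] x) i = 2 * min (hd (f^[i] x)) (qu (f^[i] x) 0) := fun x i hi => by
    have := hf.qu_iterate x hi
    rwa [scale_two, scale_two, one_mul, one_mul] at this
  have hmin : ∀ i, 2 ^ k * min (hd (f^[i] x)) (qu (f^[i] x) 0) ∈ integers := fun i => by
    have := (hx.iterate h2 hf i).min_mem
    rwa [scale_two, mul_one] at this
  cases k with
  | zero =>
    refine ⟨n, eq_v₁_iff.2 fun i hi => ?_⟩
    have e := hq x i hi
    have hle := qu_le_one (f^[n] x) hi
    rcases (le_min (hd_nonneg (f^[i] x)) (qu_nonneg (f^[i] x) 0)).eq_or_lt with h | h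
    · rw [e, ← h, mul_zero]
    · have hm := hmin i
      rw [pow_zero, one_mul] at hm
      linarith [one_le_of_mem_integers hm h]
  | succ k =>
    have : InLattice integers (2 ^ k) (f^[n] x) := by
      refine ⟨⟨2 ^ k, by simp⟩, fun i hi => ?_⟩
      rw [hq x i hi, ← mul_assoc, ← pow_succ]
      exact hmin i
    obtain ⟨t, ht⟩ := exists_iterate_eq_v₁_of_two hf k this
    exact ⟨t + n, by rw [Function.iterate_add_apply, ht]⟩

omit [NeZero n] in
theorem inLattice_of_coords (hr : r ∈ A) (h : ∀ i, r * x.1 i ∈ A) : InLattice A r x := by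
  refine ⟨hr, fun i _ => ?_⟩
  have : ∀ j, r * ext x j ∈ A := fun j => by
    unfold ext
    split_ifs
    · exact h _
    · rw [mul_zero]; exact A.zero_mem
  rw [qu, mul_sub]
  exact A.sub_mem (this _) (this _)

omit [NeZero n] in
theorem IsRationalPoint.exists_lattice (hx : IsRationalPoint x) :
    ∃ N : ℕ, 0 < N ∧ InLattice integers N x := by
  choose q hq using hx
  have key : ∀ i, ((∏ j, (q j).den : ℕ) : ℝ) * x.1 i ∈ integers := by
    intro i
    obtain ⟨c, hc⟩ := Finset.dvd_prod_of_mem (fun j => (q j).den) (Finset.mem_univ i)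
    refine ⟨(c : ℤ) * (q i).num, ?_⟩
    have h1 : ((q i).num : ℝ) = (q i).den * x.1 i := by
      rw [hq i, mul_comm]
      exact_mod_cast (Rat.mul_den_eq_num (q i)).symm
    rw [hc]
    simp [h1]
    ring
  refine ⟨∏ j, (q j).den, Finset.prod_pos fun j _ => (q j).den_pos,
    inLattice_of_coords ⟨(∏ j, (q j).den : ℕ), by simp⟩ key⟩

omit [NeZero n] in
theorem IsDyadicPoint.exists_lattice (hx : IsDyadicPoint x) :
    ∃ k : ℕ, InLattice integers (2 ^ k) x := by
  choose a m h using hx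
  refine ⟨∑ i, m i, inLattice_of_coords ⟨2 ^ ∑ i, m i, by simp⟩ fun i => ?_⟩
  obtain ⟨c, hc⟩ := Nat.exists_eq_add_of_le
    (Finset.single_le_sum (f := m) (fun j _ => Nat.zero_le _) (Finset.mem_univ i))
  refine ⟨2 ^ c * a i, ?_⟩
  rw [hc, h i, pow_add]
  simp
  field_simp

/-! ### Pulling coordinates back -/

omit [NeZero n] in
theorem coords_mem_of_qu {K : IntermediateField ℚ ℝ} (h : ∀ i < n, qu x i ∈ K) (i : Fin n) :
    x.1 i ∈ K := by
  rw [coord_eq_sum]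
  refine sum_mem fun k hk => h k ?_
  have := Finset.mem_range.1 hk
  omega

theorem kappa_mem (hκ : κ = 1 ∨ κ = 2) (K : IntermediateField ℚ ℝ) : κ ∈ K := by
  rcases hκ with rfl | rfl
  · exact K.one_mem
  · exact ofNat_mem K 2

/-- The field generated by the coordinates of a point does not grow under inverse branches. -/
theorem IsModel.qu_mem_of_map (hκ : κ = 1 ∨ κ = 2) (hf : IsModel κ f) {K : IntermediateField ℚ ℝ}
    (h : ∀ i < n, qu (f x) i ∈ K) : ∀ i < n, qu x i ∈ K := by
  have hn : 0 < n := Nat.pos_of_ne_zero (NeZero.ne n)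
  have hκ0 := (kappa_pos hκ).ne'
  have hκK := kappa_mem hκ K
  have hh : hd (f x) ∈ K := by
    rw [show hd (f x) = 1 - ∑ i ∈ Finset.range n, qu (f x) i by rw [← hd_add_sum (f x)]; ring]
    exact K.sub_mem K.one_mem (sum_mem fun i hi => h i (Finset.mem_range.1 hi))
  obtain ⟨a, ha⟩ := mem_half_cases x
  obtain ⟨e1, e2⟩ := hf.recover ha
  set u := (if a then 0 else κ * hd (f x)) + qu (f x) (n - 1) with hu
  set v := (if a then κ * hd (f x) else 0) + qu (f x) (n - 1) with hv
  have huK : u ∈ K := by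
    rw [hu]
    refine K.add_mem ?_ (h _ (by omega))
    split_ifs
    exacts [K.zero_mem, K.mul_mem hκK hh]
  have hvK : v ∈ K := by
    rw [hv]
    refine K.add_mem ?_ (h _ (by omega))
    split_ifs
    exacts [K.mul_mem hκK hh, K.zero_mem]
  have e1' : hd x = mass κ x * (u / κ) := by
    rw [← mul_div_assoc, ← e1, mul_div_cancel_left₀ _ hκ0]
  have e2' : qu x 0 = mass κ x * (v / κ) := by
    rw [← mul_div_assoc, ← e2, mul_div_cancel_left₀ _ hκ0]
  have hsum := hd_add_sum x
  have e3 : ∑ i ∈ Finset.range (n - 1), qu x (i + 1) =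
      mass κ x * ∑ i ∈ Finset.range (n - 1), qu (f x) i := by
    rw [Finset.mul_sum]
    refine Finset.sum_congr rfl fun i hi => (hf.shift x i ?_).symm
    have := Finset.mem_range.1 hi
    omega
  rw [sum_eq_zero_add_pred, e1', e2', e3, ← mul_add, ← mul_add] at hsum
  have hmass : mass κ x ∈ K := by
    rw [eq_inv_of_mul_eq_one_left hsum]
    refine K.inv_mem (K.add_mem (K.div_mem huK hκK) (K.add_mem (K.div_mem hvK hκK)
      (sum_mem fun i hi => h i ?_)))
    have := Finset.mem_range.1 hi
    omega
  intro i hi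
  rcases i with _ | i
  · rw [e2']
    exact K.mul_mem hmass (K.div_mem hvK hκK)
  · rw [← hf.shift x i hi]
    exact K.mul_mem hmass (h i (by omega))

theorem IsModel.qu_mem_of_iterate (hκ : κ = 1 ∨ κ = 2) (hf : IsModel κ f)
    {K : IntermediateField ℚ ℝ} (t : ℕ) {x : Delta n} (h : ∀ i < n, qu (f^[t] x) i ∈ K) :
    ∀ i < n, qu x i ∈ K := by
  induction t generalizing x with
  | zero => exact h
  | succ t ih => exact hf.qu_mem_of_map hκ (ih h)

omit [NeZero n] in
theorem isRationalPoint_of_mem_bot (h : ∀ i < n, qu x i ∈ (⊥ : IntermediateField ℚ ℝ)) :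
    IsRationalPoint x := fun i => by
  obtain ⟨q, hq⟩ := IntermediateField.mem_bot.1 (coords_mem_of_qu h i)
  exact ⟨q, by simpa using hq.symm⟩

/-- The additive group of the dyadic rationals, as real numbers. -/
def dyadics : AddSubgroup ℝ where
  carrier := {r | ∃ (a : ℤ) (m : ℕ), r = (a : ℝ) / 2 ^ m}
  zero_mem' := ⟨0, 0, by simp⟩
  add_mem' := by
    rintro _ _ ⟨a, m, rfl⟩ ⟨b, k, rfl⟩
    refine ⟨a * 2 ^ k + b * 2 ^ m, m + k, ?_⟩
    push_cast
    rw [pow_add]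
    field_simp
  neg_mem' := by
    rintro _ ⟨a, m, rfl⟩
    exact ⟨-a, m, by push_cast; ring⟩

theorem half_mem_dyadics (h : r ∈ dyadics) : r / 2 ∈ dyadics := by
  obtain ⟨a, m, rfl⟩ := h
  exact ⟨a, m + 1, by rw [pow_succ]; field_simp⟩

theorem one_mem_dyadics : (1 : ℝ) ∈ dyadics := ⟨1, 0, by simp⟩

theorem IsModel.dyadic_of_map (hf : IsModel 2 f) (h : ∀ i < n, qu (f x) i ∈ dyadics) :
    ∀ i < n, qu x i ∈ dyadics := by
  have hn : 0 < n := Nat.pos_of_ne_zero (NeZero.ne n)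
  have hmass : mass 2 x = 1 := by simp [mass]
  have hh : hd (f x) ∈ dyadics := by
    have := InLattice.hd_mem (A := dyadics) (r := 1) (x := f x)
      ⟨one_mem_dyadics, by simpa using h⟩
    rwa [one_mul] at this
  obtain ⟨a, ha⟩ := mem_half_cases x
  have e := (hf.recover ha).2
  rw [hmass, one_mul] at e
  intro i hi
  rcases i with _ | i
  · rw [show qu x 0 = 2 * qu x 0 / 2 by ring, e]
    refine half_mem_dyadics (dyadics.add_mem ?_ (h _ (by omega)))
    split_ifs
    · rw [two_mul]; exact dyadics.add_mem hh hh
    · exact dyadics.zero_mem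
  · rw [← hf.shift x i hi, hmass, one_mul]
    exact h i (by omega)

theorem isRationalPoint_iff (hf : IsModel 1 f) :
    IsRationalPoint x ↔ ∃ t, f^[t] x = v₁ n := by
  constructor
  · intro h
    obtain ⟨N, hN, hl⟩ := h.exists_lattice
    exact exists_iterate_eq_v₁_of_one hf N (by exact_mod_cast hN) le_rfl hl
  · rintro ⟨t, ht⟩
    refine isRationalPoint_of_mem_bot (hf.qu_mem_of_iterate (Or.inl rfl) t fun i _ => ?_)
    rw [ht, qu_v₁]
    exact zero_mem _

theorem isDyadicPoint_iff (hf : IsModel 2 f) :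
    IsDyadicPoint x ↔ ∃ t, f^[t] x = v₁ n := by
  constructor
  · intro h
    obtain ⟨k, hl⟩ := h.exists_lattice
    exact exists_iterate_eq_v₁_of_two hf k hl
  · rintro ⟨t, ht⟩
    have key : ∀ i < n, qu x i ∈ dyadics := by
      induction t generalizing x with
      | zero =>
        intro i _
        rw [show x = v₁ n from ht, qu_v₁]
        exact dyadics.zero_mem
      | succ t ih => exact hf.dyadic_of_map (ih ht)
    intro i
    rw [coord_eq_sum]
    refine dyadics.sum_mem fun k hk => key k ?_
    have := Finset.mem_range.1 hk
    omega

end GrandOrbit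

/-! ### Vertices of the partitions -/

section Vertices

variable {n : ℕ} [NeZero n] {κ : ℝ} {f : Delta n → Delta n} {x y z : Delta n}

/-- In barycentric coordinates, `z` is a combination of `x` and `y` with positive weights. -/
def Between (x y z : Delta n) : Prop :=
  ∃ α β : ℝ, 0 < α ∧ 0 < β ∧ hd z = α * hd x + β * hd y ∧
    ∀ i < n, qu z i = α * qu x i + β * qu y i

theorem between_iff : Between x y z ↔ z.1 ∈ openSegment ℝ x.1 y.1 := by
  constructor
  · rintro ⟨α, β, hα, hβ, hh, hq⟩
    have hsum : ∀ m ≤ n, ∑ i ∈ Finset.range m, qu z i =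
        α * ∑ i ∈ Finset.range m, qu x i + β * ∑ i ∈ Finset.range m, qu y i := by
      intro m hm
      rw [Finset.mul_sum, Finset.mul_sum, ← Finset.sum_add_distrib]
      refine Finset.sum_congr rfl fun i hi => hq i ?_
      have := Finset.mem_range.1 hi
      omega
    refine ⟨α, β, hα, hβ, ?_, ?_⟩
    · have hx := hd_add_sum x
      have hy := hd_add_sum y
      have hz := hd_add_sum z
      rw [hh, hsum n le_rfl] at hz
      linear_combination hz - α * hx - β * hy
    · funext i
      rw [Pi.add_apply, Pi.smul_apply, Pi.smul_apply, smul_eq_mul, smul_eq_mul, coord_eq_sum z,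
        coord_eq_sum x, coord_eq_sum y, hsum _ (Nat.sub_le _ _)]
  · rintro ⟨α, β, hα, hβ, hab, hz⟩
    have hc : ∀ i, z.1 i = α * x.1 i + β * y.1 i := fun i => by rw [← hz]; rfl
    have he : ∀ j, ext z j = α * ext x j + β * ext y j := fun j => by
      unfold ext
      split_ifs
      · exact hc _
      · simp
    refine ⟨α, β, hα, hβ, ?_, fun i _ => ?_⟩
    · simp only [hd, hc]; linear_combination -hab
    · simp only [qu, he]; ring

theorem Between.mem_half (h : Between x y z) {a : Bool} (hx : x ∈ half n a) (hy : y ∈ half n a) :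
    z ∈ half n a := by
  have hn : 0 < n := Nat.pos_of_ne_zero (NeZero.ne n)
  obtain ⟨α, β, hα, hβ, hh, hq⟩ := h
  have e : sgm z = α * sgm x + β * sgm y := by rw [sgm, sgm, sgm, hh, hq 0 hn]; ring
  cases a
  · rw [mem_half_false] at *
    rw [e]; positivity
  · rw [mem_half_true] at *
    rw [e]
    exact add_nonpos (mul_nonpos_of_nonneg_of_nonpos hα.le hx)
      (mul_nonpos_of_nonneg_of_nonpos hβ.le hy)

theorem IsModel.between_map (hκ : κ = 1 ∨ κ = 2) (hf : IsModel κ f) {a : Bool}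
    (hx : x ∈ half n a) (hy : y ∈ half n a) (h : Between x y z) :
    Between (f x) (f y) (f z) := by
  have hn : 0 < n := Nat.pos_of_ne_zero (NeZero.ne n)
  have hz := h.mem_half hx hy
  obtain ⟨α, β, hα, hβ, hh, hq⟩ := h
  have px := mass_pos hκ x
  have py := mass_pos hκ y
  have pz := mass_pos hκ z
  have hq0 := hq 0 hn
  have key : ∀ {u v w : ℝ}, mass κ z * w = α * (mass κ x * u) + β * (mass κ y * v) →
      w = α * mass κ x / mass κ z * u + β * mass κ y / mass κ z * v := by
    intro u v w h
    field_simp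
    linarith
  refine ⟨α * mass κ x / mass κ z, β * mass κ y / mass κ z, by positivity, by positivity,
    key ?_, fun i hi => key ?_⟩
  · rw [hf.head, hf.head, hf.head]
    cases a
    · rw [mem_half_false] at hx hy hz
      rw [abs_of_nonneg hx, abs_of_nonneg hy, abs_of_nonneg hz]
      simp only [sgm, hh, hq0]; ring
    · rw [mem_half_true] at hx hy hz
      rw [abs_of_nonpos hx, abs_of_nonpos hy, abs_of_nonpos hz]
      simp only [sgm, hh, hq0]; ring
  · rcases Nat.lt_or_ge (i + 1) n with h' | h'
    · rw [hf.shift _ _ h', hf.shift _ _ h', hf.shift _ _ h', hq _ h']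
    · obtain rfl : i = n - 1 := by omega
      rw [hf.push, hf.push, hf.push]
      cases a
      · rw [mem_half_false, sgm] at hx hy hz
        rw [min_eq_right (by linarith), min_eq_right (by linarith), min_eq_right (by linarith), hq0]
        ring
      · rw [mem_half_true, sgm] at hx hy hz
        rw [min_eq_left (by linarith), min_eq_left (by linarith), min_eq_left (by linarith), hh]
        ring

theorem IsModel.between_of_map (hκ : κ = 1 ∨ κ = 2) (hf : IsModel κ f) {a : Bool}
    (hx : x ∈ half n a) (hy : y ∈ half n a) (hz : z ∈ half n a)
    (h : Between (f x) (f y) (f z)) : Between x y z := by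
  have hn : 0 < n := Nat.pos_of_ne_zero (NeZero.ne n)
  obtain ⟨α, β, hα, hβ, hh, hq⟩ := h
  have px := mass_pos hκ x
  have py := mass_pos hκ y
  have pz := mass_pos hκ z
  have hκ0 := (kappa_pos hκ).ne'
  obtain ⟨x1, x2⟩ := hf.recover hx
  obtain ⟨y1, y2⟩ := hf.recover hy
  obtain ⟨z1, z2⟩ := hf.recover hz
  have hl := hq (n - 1) (by omega)
  have key : ∀ {c r s t u v w : ℝ}, c ≠ 0 → c * r = mass κ x * u → c * s = mass κ y * v →
      c * t = mass κ z * w → w = α * u + β * v →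
      t = mass κ z * α / mass κ x * r + mass κ z * β / mass κ y * s := by
    intro c r s t u v w hc h1 h2 h3 h4
    obtain rfl : u = c * r / mass κ x := by rw [h1]; field_simp
    obtain rfl : v = c * s / mass κ y := by rw [h2]; field_simp
    apply mul_left_cancel₀ hc
    rw [h3, h4]
    field_simp
  refine ⟨mass κ z * α / mass κ x, mass κ z * β / mass κ y, by positivity, by positivity,
    key hκ0 x1 y1 z1 ?_, fun i hi => ?_⟩
  · rw [hl, hh]
    split_ifs <;> ring
  · rcases i with _ | i
    · refine key hκ0 x2 y2 z2 ?_
      rw [hl, hh]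
      split_ifs <;> ring
    · refine key one_ne_zero (u := qu (f x) i) (v := qu (f y) i) (w := qu (f z) i) ?_ ?_ ?_
        (hq i (by omega))
      · rw [hf.shift x i hi, one_mul]
      · rw [hf.shift y i hi, one_mul]
      · rw [hf.shift z i hi, one_mul]

/-- The first `t` points of the orbit of `x` lie in the halves prescribed by `w`. -/
def InCell (f : Delta n → Delta n) (w : ℕ → Bool) (t : ℕ) (x : Delta n) : Prop :=
  ∀ s < t, f^[s] x ∈ half n (w s)

theorem InCell.head {w : ℕ → Bool} {t : ℕ} (h : InCell f w (t + 1) x) : x ∈ half n (w 0) :=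
  h 0 (Nat.succ_pos t)

theorem InCell.tail {w : ℕ → Bool} {t : ℕ} (h : InCell f w (t + 1) x) :
    InCell f (fun s => w (s + 1)) t (f x) := fun s hs => by
  rw [← Function.iterate_succ_apply]; exact h (s + 1) (by omega)

theorem InCell.iterate_injective (hκ : κ = 1 ∨ κ = 2) (hf : IsModel κ f) {t : ℕ} :
    ∀ {w : ℕ → Bool} {x y : Delta n}, InCell f w t x → InCell f w t y → f^[t] x = f^[t] y →
      x = y := by
  induction t with
  | zero => intro w x y _ _ h; exact h
  | succ t ih =>
    intro w x y hx hy h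
    exact hf.injOn_half hκ hx.head hy.head (ih hx.tail hy.tail h)

theorem InCell.between_iterate (hκ : κ = 1 ∨ κ = 2) (hf : IsModel κ f) {t : ℕ} :
    ∀ {w : ℕ → Bool} {x y z : Delta n}, InCell f w t x → InCell f w t y → Between x y z →
      Between (f^[t] x) (f^[t] y) (f^[t] z) := by
  induction t with
  | zero => intro w x y z _ _ h; exact h
  | succ t ih =>
    intro w x y z hx hy h
    exact ih hx.tail hy.tail (hf.between_map hκ hx.head hy.head h)

theorem InCell.between_of_iterate (hκ : κ = 1 ∨ κ = 2) (hf : IsModel κ f) {t : ℕ} :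
    ∀ {w : ℕ → Bool} {x y z : Delta n}, InCell f w t x → InCell f w t y → InCell f w t z →
      Between (f^[t] x) (f^[t] y) (f^[t] z) → Between x y z := by
  induction t with
  | zero => intro w x y z _ _ _ h; exact h
  | succ t ih =>
    intro w x y z hx hy hz h
    exact hf.between_of_map hκ hx.head hy.head hz.head (ih hx.tail hy.tail hz.tail h)

theorem exists_inCell (hκ : κ = 1 ∨ κ = 2) (hf : IsModel κ f) (t : ℕ) :
    ∀ (w : ℕ → Bool) (y : Delta n), ∃ x, InCell f w t x ∧ f^[t] x = y := by
  induction t with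
  | zero => exact fun w y => ⟨y, fun s hs => absurd hs (Nat.not_lt_zero s), rfl⟩
  | succ t ih =>
    intro w y
    obtain ⟨z, hz, hzy⟩ := ih (fun s => w (s + 1)) y
    obtain ⟨x, hx, rfl⟩ := hf.exists_preimage hκ (w 0) z
    refine ⟨x, fun s hs => ?_, hzy⟩
    rcases s with _ | s
    · exact hx
    · rw [Function.iterate_succ_apply]; exact hz s (by omega)

theorem mem_cell_iff {w : ℕ → Bool} {t : ℕ} :
    x ∈ cell f (fun i : Fin t => w i) ↔ InCell f w t x :=
  ⟨fun h s hs => h ⟨s, hs⟩, fun h i => h i i.2⟩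

/-- A point of a cell is a vertex of the cell exactly if `fᵗ`, which identifies the cell with `Δ`
and preserves segments, maps it to a vertex of `Δ`. -/
theorem extremePoint_cell_iff (hκ : κ = 1 ∨ κ = 2) (hf : IsModel κ f) {w : ℕ → Bool} {t : ℕ} :
    x.1 ∈ (Subtype.val '' cell f (fun i : Fin t => w i)).extremePoints ℝ ↔
      InCell f w t x ∧ (f^[t] x).1 ∈ (Delta n).extremePoints ℝ := by
  rw [mem_extremePoints_iff_left, mem_extremePoints_iff_left]
  constructor
  · rintro ⟨⟨x', hx', hxx⟩, h⟩
    obtain rfl : x' = x := Subtype.ext hxx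
    have hc := mem_cell_iff.1 hx'
    refine ⟨hc, (f^[t] x').2, fun u hu v hv huv => ?_⟩
    obtain ⟨y, hy, hyu⟩ := exists_inCell hκ hf t w ⟨u, hu⟩
    obtain ⟨z, hz, hzv⟩ := exists_inCell hκ hf t w ⟨v, hv⟩
    have hb : Between (f^[t] y) (f^[t] z) (f^[t] x') := by
      rw [between_iff, hyu, hzv]; exact huv
    have := h y.1 ⟨y, mem_cell_iff.2 hy, rfl⟩ z.1 ⟨z, mem_cell_iff.2 hz, rfl⟩
      (between_iff.1 (InCell.between_of_iterate hκ hf hy hz hc hb))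
    rw [← Subtype.ext this, hyu]
  · rintro ⟨hc, -, h⟩
    refine ⟨⟨x, mem_cell_iff.2 hc, rfl⟩, ?_⟩
    rintro _ ⟨y, hy, rfl⟩ _ ⟨z, hz, rfl⟩ hyz
    rw [mem_cell_iff] at hy hz
    have := h _ (f^[t] y).2 _ (f^[t] z).2
      (between_iff.1 (InCell.between_iterate hκ hf hy hz (between_iff.2 hyz)))
    rw [InCell.iterate_injective hκ hf hy hc (Subtype.ext this)]

theorem v₁_mem_extremePoints : (v₁ n).1 ∈ (Delta n).extremePoints ℝ := by
  rw [mem_extremePoints_iff_left]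
  refine ⟨(v₁ n).2, fun x hx y hy h => ?_⟩
  obtain ⟨α, β, hα, hβ, -, hq⟩ := (between_iff (x := ⟨x, hx⟩) (y := ⟨y, hy⟩)).2 h
  have : (⟨x, hx⟩ : Delta n) = v₁ n := by
    refine eq_v₁_iff.2 fun i hi => ?_
    have h1 := mul_nonneg hα.le (qu_nonneg ⟨x, hx⟩ i)
    have h2 := mul_nonneg hβ.le (qu_nonneg ⟨y, hy⟩ i)
    have h3 := hq i hi
    rw [qu_v₁] at h3
    exact (mul_eq_zero.1 (le_antisymm (by linarith) h1)).resolve_left hα.ne'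
  exact congrArg Subtype.val this

theorem isVertex_iff (hκ : κ = 1 ∨ κ = 2) (hf : IsModel κ f)
    (hv : ∀ y : Delta n, y.1 ∈ Set.range (vertex n) → ∃ t, f^[t] y = v₁ n) :
    (∃ t, IsVertexOfTimePartition f t x) ↔ ∃ t, f^[t] x = v₁ n := by
  constructor
  · rintro ⟨t, _, ⟨a, rfl⟩, h⟩
    let w : ℕ → Bool := fun s => if hs : s < t then a ⟨s, hs⟩ else false
    have hw : a = fun i : Fin t => w i := by funext i; simp [w]
    rw [hw] at h
    have h2 := ((extremePoint_cell_iff hκ hf).1 h).2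
    obtain ⟨s, hs⟩ := hv _ (extremePoints_convexHull_subset h2)
    exact ⟨s + t, by rw [Function.iterate_add_apply, hs]⟩
  · rintro ⟨t, ht⟩
    choose w hw using fun s => mem_half_cases (f^[s] x)
    refine ⟨t, _, ⟨fun i => w i, rfl⟩, (extremePoint_cell_iff hκ hf).2 ⟨fun s _ => hw s, ?_⟩⟩
    rw [ht]
    exact v₁_mem_extremePoints

omit [NeZero n] in
theorem vertex_coord (j : Fin (n + 1)) (i : Fin n) : ∃ k : ℤ, vertex n j i = k := by
  unfold vertex
  split_ifs
  exacts [⟨1, by simp⟩, ⟨0, by simp⟩]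

omit [NeZero n] in
theorem isRationalPoint_vertex (h : x.1 ∈ Set.range (vertex n)) : IsRationalPoint x := fun i => by
  obtain ⟨j, hj⟩ := h
  obtain ⟨k, hk⟩ := vertex_coord j i
  exact ⟨k, by rw [← hj, hk]; simp⟩

omit [NeZero n] in
theorem isDyadicPoint_vertex (h : x.1 ∈ Set.range (vertex n)) : IsDyadicPoint x := fun i => by
  obtain ⟨j, hj⟩ := h
  obtain ⟨k, hk⟩ := vertex_coord j i
  exact ⟨k, 0, by rw [← hj, hk]; simp⟩

end Vertices

/-! ### Preperiodic points -/

section Periodic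

open Filter Topology

variable {n : ℕ} [NeZero n] {κ c : ℝ} {w : ℕ → Bool} {h q : ℕ → ℝ}

omit [NeZero n] in
theorem IsPrimal.map {K : IntermediateField ℚ ℝ} (hκ : κ ∈ K) (hp : IsPrimal n κ w h q)
    (L : ℝ →ₗ[K] ℝ) : IsPrimal n κ w (fun t => L (h t)) (fun t => L (q t)) := by
  have hL : ∀ r, L (κ * r) = κ * L r := fun r => L.map_smul (⟨κ, hκ⟩ : K) r
  refine ⟨fun t => ?_, fun t => ?_⟩
  · simp only [hp.head t]
    split_ifs <;> exact map_sub L _ _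
  · simp only [hp.push t, hL]
    split_ifs <;> rfl

/-- A nonnegative primal run that is periodic up to the factor `c` is, up to a positive factor,
defined over every field `K` containing `c`. Indeed, a `K`-linear projection of `ℝ` onto `K` turns
it into another primal run. A small perturbation of the given run in the direction of the other one
is nonnegative, because entries that vanish do so in both runs; by uniqueness the perturbation is
trivial. -/
theorem IsPrimal.mem_of_periodic (hκ : κ = 1 ∨ κ = 2) (hp : IsPrimal n κ w h q)
    (h0 : ∀ t, 0 ≤ h t) (q0 : ∀ t, 0 ≤ q t) (hs : h 0 + ∑ i ∈ Finset.range n, q i = 1) {k : ℕ}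
    (hk : 0 < k) (hc : 0 ≤ c) (hhk : ∀ t, h (k + t) = c * h t) (hqk : ∀ t, q (k + t) = c * q t)
    {K : IntermediateField ℚ ℝ} (hcK : c ∈ K) : ∀ i < n, q i ∈ K := by
  obtain ⟨g, hg⟩ := LinearMap.exists_leftInverse_of_injective (Algebra.linearMap K ℝ)
    (LinearMap.ker_eq_bot.2 (algebraMap K ℝ).injective)
  let φ : ℝ →ₗ[K] ℝ := (Algebra.linearMap K ℝ).comp g
  have hφK : ∀ r, φ r ∈ K := fun r => (g r).2
  have hφ1 : φ 1 = 1 := by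
    have h1 : g 1 = 1 := by
      have := LinearMap.congr_fun hg 1
      simpa using this
    change ((g 1 : K) : ℝ) = 1
    rw [h1]; rfl
  let L : ℝ → ℝ →ₗ[K] ℝ := fun ε => LinearMap.id + (LinearMap.mulLeft K ε).comp (φ - LinearMap.id)
  have hL : ∀ ε r, L ε r = r + ε * (φ r - r) := fun ε r => rfl
  have small : ∀ r, 0 ≤ r → ∀ᶠ ε in 𝓝[>] (0 : ℝ), 0 ≤ L ε r := by
    intro r hr
    rcases hr.eq_or_lt with rfl | hr
    · exact Eventually.of_forall fun ε => by rw [map_zero]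
    · have hcont : Continuous fun ε => L ε r := by simp only [hL]; fun_prop
      have : Tendsto (fun ε => L ε r) (𝓝[>] 0) (𝓝 (L 0 r)) :=
        (hcont.tendsto 0).mono_left nhdsWithin_le_nhds
      have hpos : 0 < L 0 r := by rw [hL, zero_mul, add_zero]; exact hr
      exact (this.eventually (lt_mem_nhds hpos)).mono fun ε hε => hε.le
  have hev : ∀ᶠ ε in 𝓝[>] (0 : ℝ), ∀ t ∈ Finset.range k, 0 ≤ L ε (h t) ∧ 0 ≤ L ε (q t) :=
    (eventually_all_finset _).2 fun t _ => (small _ (h0 t)).and (small _ (q0 t))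
  obtain ⟨ε, hε, hε0⟩ := (hev.and self_mem_nhdsWithin).exists
  have hε0 : 0 < ε := hε0
  have hLc : ∀ r, L ε (c * r) = c * L ε r := fun r => (L ε).map_smul (⟨c, hcK⟩ : K) r
  have hnn : ∀ t, 0 ≤ L ε (h t) ∧ 0 ≤ L ε (q t) := by
    intro t
    induction t using Nat.strong_induction_on with
    | _ t ih =>
      rcases Nat.lt_or_ge t k with ht | ht
      · exact hε t (Finset.mem_range.2 ht)
      · obtain ⟨d, rfl⟩ := Nat.exists_eq_add_of_le ht
        obtain ⟨i1, i2⟩ := ih d (by omega)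
        rw [hhk, hqk, hLc, hLc]
        exact ⟨mul_nonneg hc i1, mul_nonneg hc i2⟩
  intro i hi
  have huniq := IsPrimal.unique hκ hp h0 q0 hs (hp.map (kappa_mem hκ K) (L ε)) (fun t => (hnn t).1)
    (fun t => (hnn t).2) (by rw [← map_sum, ← map_add, hs, hL, hφ1]; ring) i hi
  simp only [hL] at huniq
  have hz : ε * (φ (q i) - q i) = 0 := by linarith
  have := sub_eq_zero.1 ((mul_eq_zero.1 hz).resolve_left hε0.ne')
  rw [← this]
  exact hφK _

/-- The factor `c` is an eigenvalue of a rational matrix of size `n + 1`: the rational span of the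
initial data of the run contains `1` and is stable under multiplication by `c`. -/
theorem IsPrimal.finrank_le_of_periodic (hκ : κ = 1 ∨ κ = 2) (hp : IsPrimal n κ w h q)
    (hs : h 0 + ∑ i ∈ Finset.range n, q i = 1) {k : ℕ}
    (hhk : ∀ t, h (k + t) = c * h t) (hqk : ∀ t, q (k + t) = c * q t) :
    FiniteDimensional ℚ (IntermediateField.adjoin ℚ {c}) ∧
      Module.finrank ℚ (IntermediateField.adjoin ℚ {c}) ≤ n + 1 := by
  have hn : 0 < n := Nat.pos_of_ne_zero (NeZero.ne n)
  let b : Fin (n + 1) → ℝ := Fin.cases (h 0) (fun i => q i)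
  let V : Submodule ℚ ℝ := Submodule.span ℚ (Set.range b)
  have hfd : FiniteDimensional ℚ V := FiniteDimensional.span_of_finite ℚ (Set.finite_range b)
  have hV : Module.finrank ℚ V ≤ n + 1 := by
    have := finrank_range_le_card (R := ℚ) b
    rwa [Fintype.card_fin] at this
  have hV0 : h 0 ∈ V := Submodule.subset_span ⟨0, rfl⟩
  have hVq : ∀ i < n, q i ∈ V := fun i hi => Submodule.subset_span ⟨Fin.succ ⟨i, hi⟩, rfl⟩
  have hκV : ∀ r ∈ V, κ * r ∈ V := by
    intro r hr
    rcases hκ with rfl | rfl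
    · rwa [one_mul]
    · rw [two_mul]; exact V.add_mem hr hr
  have hall : ∀ t, h t ∈ V ∧ ∀ i < n, q (t + i) ∈ V := by
    intro t
    induction t with
    | zero => exact ⟨hV0, fun i hi => by rw [zero_add]; exact hVq i hi⟩
    | succ t ih =>
      obtain ⟨i1, i2⟩ := ih
      have i0 := i2 0 hn
      rw [add_zero] at i0
      refine ⟨?_, forall_window_succ (R := fun i => q i ∈ V) i2 ?_⟩
      · rw [hp.head t]
        split_ifs
        exacts [V.sub_mem i0 i1, V.sub_mem i1 i0]
      · simp only [hp.push t]
        refine hκV _ ?_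
        split_ifs
        exacts [i1, i0]
  have hcV : ∀ v ∈ V, c * v ∈ V := by
    intro v hv
    induction hv using Submodule.span_induction with
    | mem v hv =>
      obtain ⟨j, rfl⟩ := hv
      refine Fin.cases ?_ (fun i => ?_) j
      · change c * h 0 ∈ V
        rw [← hhk]; exact (hall _).1
      · change c * q i ∈ V
        rw [← hqk]; exact (hall _).2 i i.2
    | zero => rw [mul_zero]; exact V.zero_mem
    | add u v _ _ hu hv => rw [mul_add]; exact V.add_mem hu hv
    | smul a v _ hv => rw [mul_smul_comm]; exact V.smul_mem a hv
  have h1 : (1 : ℝ) ∈ V := by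
    rw [← hs]
    exact V.add_mem hV0 (V.sum_mem fun i hi => hVq i (Finset.mem_range.1 hi))
  have hadj : Subalgebra.toSubmodule (Algebra.adjoin ℚ {c}) ≤ V := by
    have key : ∀ y ∈ Algebra.adjoin ℚ {c}, ∀ v ∈ V, y * v ∈ V := by
      intro y hy
      induction hy using Algebra.adjoin_induction with
      | mem y hy => rw [Set.mem_singleton_iff.1 hy]; exact hcV
      | algebraMap a =>
        intro v hv
        rw [← Algebra.smul_def]
        exact V.smul_mem a hv
      | add y z _ _ hy hz => intro v hv; rw [add_mul]; exact V.add_mem (hy v hv) (hz v hv)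
      | mul y z _ _ hy hz => intro v hv; rw [mul_assoc]; exact hy _ (hz v hv)
    intro y hy
    have := key y hy 1 h1
    rwa [mul_one] at this
  have hfda : FiniteDimensional ℚ (Subalgebra.toSubmodule (Algebra.adjoin ℚ {c})) :=
    Submodule.finiteDimensional_of_le hadj
  have hint : IsIntegral ℚ c := IsIntegral.of_mem_of_fg (Algebra.adjoin ℚ {c})
    (Module.Finite.iff_fg.1 hfda) c (Algebra.self_mem_adjoin_singleton ℚ c)
  refine ⟨IntermediateField.adjoin.finiteDimensional hint, ?_⟩
  rw [← IntermediateField.finrank_eq_finrank_subalgebra,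
    IntermediateField.adjoin_simple_toSubalgebra_of_isAlgebraic hint.isAlgebraic]
  exact (Submodule.finrank_mono hadj).trans hV

variable {f : Delta n → Delta n} {p : Delta n}

theorem IsPreperiodic.exists_scale (hκ : κ = 1 ∨ κ = 2) (hf : IsModel κ f)
    (hp : IsPreperiodic f p) :
    ∃ x k, (FiniteDimensional ℚ (IntermediateField.adjoin ℚ {scale κ f x k}) ∧
        Module.finrank ℚ (IntermediateField.adjoin ℚ {scale κ f x k}) ≤ n + 1) ∧
      ∀ K : IntermediateField ℚ ℝ, scale κ f x k ∈ K → ∀ i, p.1 i ∈ K := by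
  obtain ⟨x, t, s, hts, hx, hx'⟩ := hp
  obtain ⟨d, rfl⟩ := Nat.exists_eq_add_of_lt hts
  have hper : f^[d + 1] x = x := by
    nth_rw 1 [hx]
    rw [← Function.iterate_add_apply, show d + 1 + t = t + d + 1 by ring, ← hx']
  have hit : ∀ u, f^[d + 1 + u] x = f^[u] x := fun u => by
    rw [add_comm, Function.iterate_add_apply, hper]
  choose w hw using fun u => mem_half_cases (f^[u] x)
  have hprim := isPrimal_run hf x hw
  have hh : ∀ u, runHead κ f x (d + 1 + u) = scale κ f x (d + 1) * runHead κ f x u := fun u => by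
    rw [runHead, scale_add, hit, hper, runHead, mul_assoc]
  have hq : ∀ u, runQueue κ f x (d + 1 + u) = scale κ f x (d + 1) * runQueue κ f x u :=
    fun u => by rw [runQueue, scale_add, hit, hper, runQueue, mul_assoc]
  refine ⟨x, d + 1, hprim.finrank_le_of_periodic hκ (run_sum hf x) hh hq, fun K hK => ?_⟩
  refine coords_mem_of_qu (hf.qu_mem_of_iterate hκ t fun i hi => ?_)
  rw [← hx, ← runQueue_of_lt hf x hi]
  exact hprim.mem_of_periodic hκ (runHead_nonneg hκ x) (runQueue_nonneg hκ x) (run_sum hf x)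
    (Nat.succ_pos d) (scale_pos hκ x _).le hh hq hK i hi

theorem finrank_coordField_le (hκ : κ = 1 ∨ κ = 2) (hf : IsModel κ f) (hp : IsPreperiodic f p) :
    FiniteDimensional ℚ (coordField p) ∧ Module.finrank ℚ (coordField p) ≤ n + 1 := by
  obtain ⟨x, k, ⟨h1, h2⟩, h3⟩ := hp.exists_scale hκ hf
  have hle : coordField p ≤ IntermediateField.adjoin ℚ {scale κ f x k} := by
    refine IntermediateField.adjoin_le_iff.2 ?_
    rintro _ ⟨i, rfl⟩
    exact h3 _ (IntermediateField.mem_adjoin_simple_self ℚ _) i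
  refine ⟨?_, (IntermediateField.finrank_le_of_le_right hle).trans h2⟩
  exact FiniteDimensional.of_injective (IntermediateField.inclusion hle).toLinearMap
    (IntermediateField.inclusion hle).injective

theorem isPreperiodic_of_finite {X : Type*} {f : X → X} {S : Set X} (hS : S.Finite) {p : X}
    (h : ∀ t, f^[t] p ∈ S) : IsPreperiodic f p := by
  have := hS.to_subtype
  obtain ⟨a, b, hab, he⟩ :=
    Finite.exists_ne_map_eq_of_infinite (fun t : ℕ => (⟨f^[t] p, h t⟩ : S))
  have he : f^[a] p = f^[b] p := congrArg Subtype.val he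
  rcases lt_or_gt_of_ne hab with h | h
  · exact ⟨f^[a] p, a, b, h, rfl, he⟩
  · exact ⟨f^[b] p, b, a, h, rfl, he.symm⟩

/-- The points of `Δ` with coordinates of common denominator `N` are finite in number. -/
theorem finite_inLattice {N : ℕ} (hN : 0 < N) :
    {x : Delta n | InLattice integers N x}.Finite := by
  have hN' : (0 : ℝ) < N := by exact_mod_cast hN
  have key : ∀ x : {x : Delta n | InLattice integers N x}, ∀ i : Fin n,
      ∃ k : Fin (N + 1), (k : ℝ) = N * qu x.1 i := by
    rintro ⟨x, hx⟩ i
    obtain ⟨k, hk⟩ := mem_integers.1 (hx.2 i i.2)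
    have h1 : (0 : ℝ) ≤ k := by rw [hk]; exact mul_nonneg hN'.le (qu_nonneg x i)
    have h2 : (k : ℝ) ≤ N := by
      rw [hk]; exact mul_le_of_le_one_right hN'.le (qu_le_one x i.2)
    have h1 : 0 ≤ k := by exact_mod_cast h1
    have h2 : k ≤ N := by exact_mod_cast h2
    lift k to ℕ using h1
    refine ⟨⟨k, by omega⟩, ?_⟩
    rw [← hk]
    simp
  choose φ hφ using key
  have : Finite {x : Delta n | InLattice integers N x} := by
    refine Finite.of_injective φ fun x y hxy => Subtype.ext (ext_of_qu fun i hi => ?_)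
    have e1 := hφ x ⟨i, hi⟩
    have e2 := hφ y ⟨i, hi⟩
    rw [hxy, e2] at e1
    exact (mul_left_cancel₀ hN'.ne' e1).symm
  exact Set.toFinite _

theorem isRationalPoint_iff_isPreperiodic (hf : IsModel 2 f) :
    IsRationalPoint p ↔ IsPreperiodic f p := by
  constructor
  · intro h
    obtain ⟨N, hN, hl⟩ := h.exists_lattice
    refine isPreperiodic_of_finite (finite_inLattice hN) fun t => ?_
    have := hl.iterate (Or.inr rfl) hf t
    rwa [scale_two, mul_one] at this
  · intro h
    obtain ⟨x, k, -, h3⟩ := h.exists_scale (Or.inr rfl) hf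
    intro i
    have := h3 ⊥ (by rw [scale_two]; exact one_mem _) i
    obtain ⟨r, hr⟩ := IntermediateField.mem_bot.1 this
    exact ⟨r, by simpa using hr.symm⟩

end Periodic

end Monkemeyer

theorem mainTheorem2 (n : ℕ) [NeZero n] :
    -- (i)
    (∀ p : Monkemeyer.Delta n,
      (Monkemeyer.IsRationalPoint p ↔
        Monkemeyer.EPO (Monkemeyer.M n) p = {Monkemeyer.v₁ n}) ∧
      (Monkemeyer.EPO (Monkemeyer.M n) p = {Monkemeyer.v₁ n} ↔
        ∃ t : ℕ, Monkemeyer.IsVertexOfTimePartition (Monkemeyer.M n) t p)) ∧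
    -- (ii)
    (∀ p : Monkemeyer.Delta n,
      (Monkemeyer.IsDyadicPoint p ↔
        Monkemeyer.EPO (Monkemeyer.T n) p = {Monkemeyer.v₁ n}) ∧
      (Monkemeyer.EPO (Monkemeyer.T n) p = {Monkemeyer.v₁ n} ↔
        ∃ t : ℕ, Monkemeyer.IsVertexOfTimePartition (Monkemeyer.T n) t p)) ∧
    -- the rational points and the dyadic points are grand orbits, matched by the
    -- (existing and unique) homeomorphism that conjugates the two maps
    {p : Monkemeyer.Delta n | Monkemeyer.IsRationalPoint p} =
      Monkemeyer.GO (Monkemeyer.M n) (Monkemeyer.v₁ n) ∧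
    {p : Monkemeyer.Delta n | Monkemeyer.IsDyadicPoint p} =
      Monkemeyer.GO (Monkemeyer.T n) (Monkemeyer.v₁ n) ∧
    (∃! Φ : Monkemeyer.Delta n ≃ₜ Monkemeyer.Delta n, Monkemeyer.IsMinkowski Φ) ∧
    (∀ Φ : Monkemeyer.Delta n ≃ₜ Monkemeyer.Delta n, Monkemeyer.IsMinkowski Φ →
      Set.BijOn Φ {p | Monkemeyer.IsRationalPoint p} {p | Monkemeyer.IsDyadicPoint p}) ∧
    -- (iii)
    (∀ p : Monkemeyer.Delta n, Monkemeyer.IsPreperiodic (Monkemeyer.M n) p →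
      FiniteDimensional ℚ (Monkemeyer.coordField p) ∧
      Module.finrank ℚ (Monkemeyer.coordField p) ≤ n + 1) ∧
    -- (iv)
    (∀ p : Monkemeyer.Delta n,
      Monkemeyer.IsRationalPoint p ↔ Monkemeyer.IsPreperiodic (Monkemeyer.T n) p) := by
  have hM : Monkemeyer.IsModel 1 (Monkemeyer.M n) := Monkemeyer.isModel_M
  have hT : Monkemeyer.IsModel 2 (Monkemeyer.T n) := Monkemeyer.isModel_T
  have h1 : (1 : ℝ) = 1 ∨ (1 : ℝ) = 2 := Or.inl rfl
  have h2 : (2 : ℝ) = 1 ∨ (2 : ℝ) = 2 := Or.inr rfl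
  have vM := hM.map_v₁ h1
  have vT := hT.map_v₁ h2
  refine ⟨fun p => ⟨?_, ?_⟩, fun p => ⟨?_, ?_⟩, ?_, ?_, Monkemeyer.existsUnique_isMinkowski,
    fun Φ hΦ => ?_, fun p hp => Monkemeyer.finrank_coordField_le h1 hM hp,
    fun p => Monkemeyer.isRationalPoint_iff_isPreperiodic hT⟩
  · rw [Monkemeyer.EPO_eq_singleton_iff vM, Monkemeyer.isRationalPoint_iff hM]
  · rw [Monkemeyer.EPO_eq_singleton_iff vM, Monkemeyer.isVertex_iff h1 hM fun y hy =>
      (Monkemeyer.isRationalPoint_iff hM).1 (Monkemeyer.isRationalPoint_vertex hy)]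
  · rw [Monkemeyer.EPO_eq_singleton_iff vT, Monkemeyer.isDyadicPoint_iff hT]
  · rw [Monkemeyer.EPO_eq_singleton_iff vT, Monkemeyer.isVertex_iff h2 hT fun y hy =>
      (Monkemeyer.isDyadicPoint_iff hT).1 (Monkemeyer.isDyadicPoint_vertex hy)]
  · rw [Monkemeyer.GO_eq vM]
    exact Set.ext fun p => Monkemeyer.isRationalPoint_iff hM
  · rw [Monkemeyer.GO_eq vT]
    exact Set.ext fun p => Monkemeyer.isDyadicPoint_iff hT
  · have hconj := Monkemeyer.isMinkowski_iff.1 hΦ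
    -- a fixed point is its own shadow, so that `Φ` fixes `v₁`
    have hv : Φ (Monkemeyer.v₁ n) = Monkemeyer.v₁ n := by
      refine Monkemeyer.Shadows.unique h1 h2 hM hT
        (Monkemeyer.shadows_of_conj h1 h2 hM hT hconj _) fun t => ?_
      rw [Function.iterate_fixed vM, Function.iterate_fixed vT]
      exact mul_self_nonneg _
    have key : ∀ p, Monkemeyer.IsDyadicPoint (Φ p) ↔ Monkemeyer.IsRationalPoint p := by
      intro p
      rw [Monkemeyer.isDyadicPoint_iff hT, Monkemeyer.isRationalPoint_iff hM]
      refine exists_congr fun t => ?_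
      rw [← Function.Semiconj.iterate_right (f := Φ) (fun x => hconj x) t p]
      nth_rw 1 [← hv]
      exact Φ.injective.eq_iff
    refine ⟨fun p hp => (key p).2 hp, Φ.injective.injOn, fun q hq => ?_⟩
    obtain ⟨p, rfl⟩ := Φ.surjective q
    exact ⟨p, (key p).1 hq, rfl⟩
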